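/- Let $d\ge 0$, $T>0$, $\nu\in\mathbb R$, let $\Omega\subset\mathbb R^d$ be compact, $U\supseteq\Omega$ open, and $E=[0,T]\times\Omega$. Let $\mu_1,\mu_2$ be finite Borel measures on $\mathbb R\times\mathbb R^d$ and $\mathbb R^d$ with supports contained in $E$ and $\Omega$ respectively. Let $C^{1,2}([0,T]\times U)$ be the set of continuous $u(t,x)$ on $[0,T]\times U$ for which $\partial_t u$ (one-sided at $t=0,T$), $\nabla_x u$ and $\nabla_x^2u$ exist and are continuous on $[0,T]\times U$. Let $H=H(x,\rho,p):\mathbb R^d\times\mathbb R\times\mathbb R^d\to\mathbb R$ be such that $x\mapsto H(x,\rho,p)$ is Borel measurable on $\Omega$ for all $(\rho,p)$, $p\mapsto H(x,\rho,p)$ is differentiable for all $x\in U$, $\rho\in\mathbb R$, the map $\nabla_pH$ is $C^1$ on $U\times\mathbb R\times\mathbb R^d$, and each of the functions $f=H,\ \nabla_pH,\ \nabla_{pp}H,\ \nabla_{\rho p}H$ is locally Lipschitz in $(\rho,p)$ with a constant of at most polynomial growth, uniformly in $x$: there are $K\in\mathbb R$ and $q\in\mathbb N$ such that for all $x\in\Omega$,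 $r,s\in\mathbb R$, $p,p'\in\mathbb R^d$, $$|f(x,r,p)-f(x,s,p')|\le K\,(1+|r|+|p|+|s|+|p'|)^q\,(|r-s|+|p-p'|).$$ For functions $\rho,\phi$ of $(t,x)$ put $$\mathcal H_1(\rho,\phi)=\partial_t\phi+\nu\Delta\phi-H(x,\rho,\nabla\phi),\qquad \mathcal H_2(\rho,\phi)=\partial_t\rho-\nu\Delta\rho-\operatorname{div}\big(\rho\,\nabla_pH(x,\rho,\nabla\phi)\big).$$ Let $\rho_0:\mathbb R^d\to\mathbb R$ and $g:\mathbb R^d\times\mathbb R\to\mathbb R$ be given, and let $\phi,\rho\in C^{1,2}([0,T]\times U)$ be a solution of the mean field game system $$\mathcal H_1(\rho,\phi)=0,\quad \mathcal H_2(\rho,\phi)=0\ \text{ in }E,\qquad \rho(0,x)=\rho_0(x),\quad \phi(T,x)=g(x,\rho(T,x))\ \text{ for }x\in\Omega .$$ Let $\sigma:\mathbb R\to\mathbb R$ be $C^2$, bounded and non-constant, and let $\mathcal N(\sigma)$ be the set of single-hidden-layer networks $$(t,x)\mapsto\sum_{i=1}^n\beta_i\,\sigma\Big(\alpha_it+\sum_{j=1}^d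 w_{ij}x_j+c_i\Big),\qquad n\ge1,\quad \beta_i,\alpha_i,w_{ij},c_i\in\mathbb R .$$ Then there are constants $C_1,C_2>0$ such that for every $\varepsilon>0$ there exist $\rho_\theta,\phi_\omega\in\mathcal N(\sigma)$ for which $\mathcal H_1(\rho_\theta,\phi_\omega)$ and $\mathcal H_2(\rho_\theta,\phi_\omega)$ belong to $L^2(\mu_1)$, $\phi_\omega(T,\cdot)-\phi(T,\cdot)$ and $\rho_\theta(0,\cdot)-\rho_0$ belong to $L^2(\mu_2)$, and $$L_1(\rho_\theta,\phi_\omega):=\|\mathcal H_1(\rho_\theta,\phi_\omega)\|_{L^2(\mu_1)}^2+\|\phi_\omega(T,\cdot)-\phi(T,\cdot)\|_{L^2(\mu_2)}^2\le C_1\varepsilon,$$ $$L_2(\rho_\theta,\phi_\omega):=\|\mathcal H_2(\rho_\theta,\phi_\omega)\|_{L^2(\mu_1)}^2+\|\rho_\theta(0,\cdot)-\rho_0\|_{L^2(\mu_2)}^2\le C_2\varepsilon .$$ -/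

import Mathlib

open MeasureTheory Set

noncomputable section

/-- The state space `ℝ^d` with its Euclidean structure. -/
abbrev Space (d : ℕ) : Type := EuclideanSpace ℝ (Fin d)

/-- The set `𝒩(σ)` of single-hidden-layer networks with activation `σ` and any number `n ≥ 1` of
hidden units, as functions of `(t, x) ∈ ℝ × ℝ^d`. -/
def Networks (d : ℕ) (σ : ℝ → ℝ) : Set (ℝ → Space d → ℝ) :=
  {f | ∃ n : ℕ, 1 ≤ n ∧ ∃ (β : Fin n → ℝ) (a : Fin n → ℝ) (w : Fin n → Fin d → ℝ) (c : Fin n → ℝ),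
    f = fun t x => ∑ i, β i * σ (a i * t + ∑ j, w i j * x j + c i)}

/-- The divergence `∑ i, ∂_{x_i} F_i` of a vector field. -/
def divergence {d : ℕ} (F : Space d → Space d) (x : Space d) : ℝ :=
  ∑ i, (fderiv ℝ F x (EuclideanSpace.single i 1)) i

/-- `∇_p H (x, r, p)`. -/
def gradP {d : ℕ} (H : Space d → ℝ → Space d → ℝ) (x : Space d) (r : ℝ) (p : Space d) : Space d :=
  gradient (H x r) p

/-- `∇_{pp} H (x, r, p)`, as a linear map. -/
def hessPP {d : ℕ} (H : Space d → ℝ → Space d → ℝ) (x : Space d) (r : ℝ) (p : Space d) :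
    Space d →L[ℝ] Space d :=
  fderiv ℝ (gradP H x r) p

/-- `∇_{ρp} H (x, r, p)`. -/
def gradRhoP {d : ℕ} (H : Space d → ℝ → Space d → ℝ) (x : Space d) (r : ℝ) (p : Space d) :
    Space d :=
  deriv (fun s => gradP H x s p) r

/-- `f (x, r, p)` is locally Lipschitz in `(r, p)` with a constant of at most polynomial growth
in `r` and `p`, uniformly in `x ∈ Ω`. -/
def PolyLipschitz {d : ℕ} {F : Type*} [NormedAddCommGroup F] (Ω : Set (Space d))
    (f : Space d → ℝ → Space d → F) : Prop :=
  ∃ (K : ℝ) (q : ℕ), ∀ x ∈ Ω, ∀ (r s : ℝ) (p p' : Space d),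
    ‖f x r p - f x s p'‖ ≤
      K * (1 + |r| + ‖p‖ + |s| + ‖p'‖) ^ q * (|r - s| + ‖p - p'‖)

/-- Assumptions on the Hamiltonian, on a compact `Ω` with an open neighbourhood `U`. -/
structure HamiltonianAssumptions {d : ℕ} (Ω U : Set (Space d)) (H : Space d → ℝ → Space d → ℝ) :
    Prop where
  measurable : ∀ (r : ℝ) (p : Space d), Measurable fun x : Ω => H x r p
  differentiable : ∀ x ∈ U, ∀ (r : ℝ) (p : Space d), DifferentiableAt ℝ (H x r) p
  contDiff_gradP : ContDiffOn ℝ 1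
    (fun z : Space d × ℝ × Space d => gradP H z.1 z.2.1 z.2.2) (U ×ˢ univ)
  lipschitz : PolyLipschitz Ω H
  lipschitz_gradP : PolyLipschitz Ω (gradP H)
  lipschitz_hessPP : PolyLipschitz Ω (hessPP H)
  lipschitz_gradRhoP : PolyLipschitz Ω (gradRhoP H)

/-- `u` belongs to `C^{1,2}([0, T] × U)`, where `U` is open: `u`, `∂_t u` (one-sided at the
endpoints), `∇_x u` and `∇_x² u` exist and are continuous on `[0, T] × U`. -/
structure IsC12 {d : ℕ} (T : ℝ) (U : Set (Space d)) (u : ℝ → Space d → ℝ) : Prop where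
  continuousOn : ContinuousOn (fun z : ℝ × Space d => u z.1 z.2) (Icc 0 T ×ˢ U)
  differentiable_time : ∀ x ∈ U, DifferentiableOn ℝ (fun t => u t x) (Icc 0 T)
  contDiff_space : ∀ t ∈ Icc 0 T, ContDiffOn ℝ 2 (u t) U
  continuousOn_time : ContinuousOn
    (fun z : ℝ × Space d => derivWithin (fun s => u s z.2) (Icc 0 T) z.1) (Icc 0 T ×ˢ U)
  continuousOn_fderiv : ContinuousOn
    (fun z : ℝ × Space d => fderiv ℝ (u z.1) z.2) (Icc 0 T ×ˢ U)
  continuousOn_fderiv_fderiv : ContinuousOn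
    (fun z : ℝ × Space d => fderiv ℝ (fderiv ℝ (u z.1)) z.2) (Icc 0 T ×ˢ U)

/-- `∂_t φ + ν Δφ - H(x, ρ, ∇φ)` at `(t, x)`, `t ∈ [0, T]`. -/
def hjbResidual {d : ℕ} (T ν : ℝ) (H : Space d → ℝ → Space d → ℝ) (ρ φ : ℝ → Space d → ℝ)
    (t : ℝ) (x : Space d) : ℝ :=
  derivWithin (fun s => φ s x) (Icc 0 T) t + ν * Laplacian.laplacian (φ t) x
    - H x (ρ t x) (gradient (φ t) x)

/-- `∂_t ρ - ν Δρ - div (ρ ∇_p H(x, ρ, ∇φ))` at `(t, x)`, `t ∈ [0, T]`. -/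
def fpResidual {d : ℕ} (T ν : ℝ) (H : Space d → ℝ → Space d → ℝ) (ρ φ : ℝ → Space d → ℝ)
    (t : ℝ) (x : Space d) : ℝ :=
  derivWithin (fun s => ρ s x) (Icc 0 T) t - ν * Laplacian.laplacian (ρ t) x
    - divergence (fun y => ρ t y • gradP H y (ρ t y) (gradient (φ t) y)) x

/-- `(φ, ρ)` is a classical solution of the mean field game system on `E = [0, T] × Ω`, of class
`C^{1,2}` on the neighbourhood `[0, T] × U` of `E`. -/
structure IsMFGSolution {d : ℕ} (T ν : ℝ) (Ω U : Set (Space d)) (H : Space d → ℝ → Space d → ℝ)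
    (ρ₀ : Space d → ℝ) (g : Space d → ℝ → ℝ) (φ ρ : ℝ → Space d → ℝ) : Prop where
  regular_phi : IsC12 T U φ
  regular_rho : IsC12 T U ρ
  hjb : ∀ t ∈ Icc 0 T, ∀ x ∈ Ω, hjbResidual T ν H ρ φ t x = 0
  fp : ∀ t ∈ Icc 0 T, ∀ x ∈ Ω, fpResidual T ν H ρ φ t x = 0
  initial : ∀ x ∈ Ω, ρ 0 x = ρ₀ x
  terminal : ∀ x ∈ Ω, φ T x = g x (ρ T x)

/-- The Hamilton–Jacobi–Bellman loss of `(ρ', φ')`, where `φ` is the exact value function: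
`‖residual‖²_{L²(μ₁)} + ‖φ'(T) - φ(T)‖²_{L²(μ₂)}`. -/
def hjbLoss {d : ℕ} (T ν : ℝ) (H : Space d → ℝ → Space d → ℝ) (φ : ℝ → Space d → ℝ)
    (μ₁ : Measure (ℝ × Space d)) (μ₂ : Measure (Space d)) (ρ' φ' : ℝ → Space d → ℝ) : ℝ :=
  ∫ z, |hjbResidual T ν H ρ' φ' z.1 z.2| ^ 2 ∂μ₁ + ∫ x, |φ' T x - φ T x| ^ 2 ∂μ₂

/-- The Fokker–Planck loss of `(ρ', φ')`:
`‖residual‖²_{L²(μ₁)} + ‖ρ'(0) - ρ₀‖²_{L²(μ₂)}`. -/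
def fpLoss {d : ℕ} (T ν : ℝ) (H : Space d → ℝ → Space d → ℝ) (ρ₀ : Space d → ℝ)
    (μ₁ : Measure (ℝ × Space d)) (μ₂ : Measure (Space d)) (ρ' φ' : ℝ → Space d → ℝ) : ℝ :=
  ∫ z, |fpResidual T ν H ρ' φ' z.1 z.2| ^ 2 ∂μ₁ + ∫ x, |ρ' 0 x - ρ₀ x| ^ 2 ∂μ₂

end

/-! The residuals at a point depend only on the jets `(u, ∂_t u, ∇_x u, ∇_x² u)` of the two
unknowns, and they vanish at the exact jets. So it suffices that networks approximate `C^{1,2}`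
functions together with these jets, uniformly on `[0, T] × Ω` (`IsC12.exists_network_close`), and
that the residuals are stable under small perturbations of the jets. The Fokker–Planck residual is a
continuous function of the point and the jets, since `∇_p H` is `C¹`. In the other residual `H` is
merely measurable in `x`, and its local Lipschitz bound in `(ρ, p)`, uniform in `x`, plays the role
of continuity. Residuals uniformly small on a set carrying finite measures are small in `L²`.

Approximation starts on the line (`exists_ridgeSpan_close`). A continuous linear map on `C[-R, R]`
that kills every `σ''(l s + c)` is zero (`annihilator_eq_zero`). Since `σ` is only `C²`, it is first
smoothed by moving integrals, which preserve annihilation; differentiating `k` times in `l` at `l =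
0` then shows that every monomial is killed, and Weierstrass concludes. Boundedness of `σ` ensures
that a suitable high derivative of the smoothed function is not identically zero. Approximating
`G''` and then correcting value and slope at `0` gives `C²` approximation.

Hence every ridge function `G(L(t, x))` is a limit of networks, in particular every exponential of a
linear form. Sums of exponentials approximate compactly supported `C^{1,2}` functions: powers of a
sum of exponentials peaked at the origin form an approximate identity, and convolution with them
stays in the span (`IsJetField.exists_expSpan_close`). A general `u` is reduced to this case by
contracting time towards `T / 2`, which removes the boundary of `[0, T]`, and multiplying by a
cutoff. -/

noncomputable section

/-! ### Moving integrals, finite differences and curves in `C(K)` -/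

/-- The integral of `b` over the interval from `s` to `s + h`, as a function of `s`. -/
def movingIntegral (h : ℝ) (b : ℝ → ℝ) (s : ℝ) : ℝ := ∫ y in (0 : ℝ)..h, b (s + y)

theorem hasDerivAt_movingIntegral {b : ℝ → ℝ} (hb : Continuous b) (h s : ℝ) :
    HasDerivAt (movingIntegral h b) (b (s + h) - b s) s := by
  have hI : ∀ u v, IntervalIntegrable b volume u v := fun u v => hb.intervalIntegrable u v
  have hG : ∀ s, HasDerivAt (fun u => ∫ y in (0 : ℝ)..u, b y) (b s) s := fun s =>
    intervalIntegral.integral_hasDerivAt_right (hI _ _)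
      hb.aestronglyMeasurable.stronglyMeasurableAtFilter hb.continuousAt
  have he : movingIntegral h b =
      fun s => (∫ y in (0 : ℝ)..(s + h), b y) - ∫ y in (0 : ℝ)..s, b y := by
    funext s
    rw [intervalIntegral.integral_interval_sub_left (hI _ _) (hI _ _), movingIntegral,
      intervalIntegral.integral_comp_add_left (fun y => b y) s, add_zero]
  rw [he]
  exact ((hG (s + h)).comp_add_const s h).sub (hG s)

theorem deriv_movingIntegral {b : ℝ → ℝ} (hb : Continuous b) (h : ℝ) :
    deriv (movingIntegral h b) = fun s => b (s + h) - b s :=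
  funext fun s => (hasDerivAt_movingIntegral hb h s).deriv

theorem contDiff_movingIntegral {b : ℝ → ℝ} {n : ℕ} (hb : ContDiff ℝ n b) (h : ℝ) :
    ContDiff ℝ (n + 1 : ℕ) (movingIntegral h b) := by
  push_cast
  rw [contDiff_succ_iff_deriv]
  refine ⟨fun s => (hasDerivAt_movingIntegral hb.continuous h s).differentiableAt,
    fun hn => by simp at hn, ?_⟩
  rw [deriv_movingIntegral hb.continuous]
  fun_prop

/-- If all differences were constant, `f` would grow linearly along the progression `a + n (b - a)`
with nonzero increment `f b - f a`, contradicting boundedness. -/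
theorem exists_difference_nonconstant {f : ℝ → ℝ} (hb : ∃ M : ℝ, ∀ s, |f s| ≤ M)
    (hc : ∃ a b, f a ≠ f b) : ∃ h a b, f (a + h) - f a ≠ f (b + h) - f b := by
  by_contra! H
  obtain ⟨M, hM⟩ := hb
  obtain ⟨a, b, hab⟩ := hc
  have hn : ∀ n : ℕ, f (a + n * (b - a)) = f a + n * (f b - f a) := by
    intro n
    induction n with
    | zero => simp
    | succ n ih =>
      have h1 := H (b - a) (a + n * (b - a)) a
      rw [ih, add_sub_cancel] at h1
      have h2 : a + ((n + 1 : ℕ) : ℝ) * (b - a) = a + n * (b - a) + (b - a) := by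
        push_cast; ring
      rw [h2]; push_cast; linarith
  obtain ⟨n, hn'⟩ := exists_nat_gt (2 * M / |f b - f a|)
  have hpos : 0 < |f b - f a| := abs_pos.2 (sub_ne_zero.2 hab.symm)
  rw [div_lt_iff₀ hpos] at hn'
  have h3 : (n : ℝ) * |f b - f a| = |f (a + n * (b - a)) - f a| := by
    rw [hn n, add_sub_cancel_left, abs_mul, Nat.abs_cast]
  have h4 := abs_sub (f (a + n * (b - a))) (f a)
  linarith [hM a, hM (a + n * (b - a))]

/-- Pointwise derivatives become a derivative in the sup norm because `F` equals `F 0` plus the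
integral of the continuous curve `F'` in `C(K, ℝ)`. -/
theorem hasDerivAt_continuousMap {K : Type*} [TopologicalSpace K] [CompactSpace K]
    {F F' : ℝ → C(K, ℝ)} (hF' : Continuous F')
    (h : ∀ s l, HasDerivAt (fun l => F l s) (F' l s) l) (l : ℝ) : HasDerivAt F (F' l) l := by
  have he : F = fun l => F 0 + ∫ m in (0 : ℝ)..l, F' m := by
    funext l
    ext s
    have hc : Continuous fun m => F' m s := (ContinuousMap.evalCLM ℝ s).continuous.comp hF'
    have h1 := intervalIntegral.integral_eq_sub_of_hasDerivAt (a := 0) (b := l)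
      (fun m _ => h s m) (hc.intervalIntegrable _ _)
    have h2 := (ContinuousMap.evalCLM ℝ s).intervalIntegral_comp_comm
      (hF'.intervalIntegrable (μ := volume) 0 l)
    simp only [ContinuousMap.evalCLM_apply] at h2
    rw [ContinuousMap.add_apply, ← h2, h1]
    ring
  rw [he]
  exact (intervalIntegral.integral_hasDerivAt_right (hF'.intervalIntegrable _ _)
      hF'.aestronglyMeasurable.stronglyMeasurableAtFilter hF'.continuousAt).const_add _

/-- The function `s ↦ s ^ k * b (l * s + c)` on a compact interval. -/
def ridgeMap (R : ℝ) (k : ℕ) (b : C(ℝ, ℝ)) (l c : ℝ) : C(Icc (-R) R, ℝ) :=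
  ⟨fun s => (s : ℝ) ^ k * b (l * s + c), by fun_prop⟩

theorem continuous_ridgeMap (R : ℝ) (k : ℕ) (b : C(ℝ, ℝ)) {X : Type*} [TopologicalSpace X]
    {l c : X → ℝ} (hl : Continuous l) (hc : Continuous c) :
    Continuous fun x => ridgeMap R k b (l x) (c x) := by
  refine ContinuousMap.continuous_of_continuous_uncurry _ ?_
  simp only [Function.uncurry_def, ridgeMap, ContinuousMap.coe_mk]
  fun_prop

/-! ### Linear maps killing all dilates and translates of `σ''` -/

section Annihilator

variable {Y : Type*} [NormedAddCommGroup Y] [NormedSpace ℝ Y] {R : ℝ}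
  {L : C(Icc (-R) R, ℝ) →L[ℝ] Y}

/-- The ridge map of a moving integral is a `C[-R, R]`-valued integral of translated ridge maps, and
`L` commutes with the integral. -/
theorem map_ridgeMap_movingIntegral [CompleteSpace Y] {b b' : C(ℝ, ℝ)} {h : ℝ}
    (hb' : ∀ s, b' s = movingIntegral h b s) (hL : ∀ l c, L (ridgeMap R 0 b l c) = 0) (l c : ℝ) :
    L (ridgeMap R 0 b' l c) = 0 := by
  have hcont : Continuous fun y => ridgeMap R 0 b l (c + y) :=
    continuous_ridgeMap R 0 b continuous_const (by fun_prop)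
  have he : ridgeMap R 0 b' l c = ∫ y in (0 : ℝ)..h, ridgeMap R 0 b l (c + y) := by
    ext s
    have h2 := (ContinuousMap.evalCLM ℝ s).intervalIntegral_comp_comm
      (hcont.intervalIntegrable (μ := volume) 0 h)
    simp only [ContinuousMap.evalCLM_apply] at h2
    rw [← h2]
    simp [ridgeMap, hb', movingIntegral, add_assoc]
  rw [he, ← L.intervalIntegral_comp_comm (hcont.intervalIntegrable _ _)]
  simp [hL]

/-- Differentiating `s ^ k * b⁽ᵏ⁾ (l * s + c)` in `l` produces one more factor `s` and one more
derivative of `b`; `L` of this curve is constantly zero, so `L` kills its derivative. -/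
theorem map_ridgeMap_iteratedDeriv (k : ℕ) {b b' : C(ℝ, ℝ)} (hb : ContDiff ℝ k b)
    (hb' : ∀ s, b' s = iteratedDeriv k b s) (hL : ∀ l c, L (ridgeMap R 0 b l c) = 0) (l c : ℝ) :
    L (ridgeMap R k b' l c) = 0 := by
  induction k generalizing b' l c with
  | zero =>
    have : b' = b := by ext s; simp [hb']
    rw [this]; exact hL l c
  | succ k ih =>
    have hbk : ContDiff ℝ k b := hb.of_le (by norm_cast; omega)
    have hcont : Continuous (iteratedDeriv k b) := hbk.continuous_iteratedDeriv k le_rfl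
    have hd : ∀ s, HasDerivAt (iteratedDeriv k b) (b' s) s := by
      intro s
      rw [hb', iteratedDeriv_succ]
      exact (hb.differentiable_iteratedDeriv k (by norm_cast; omega) s).hasDerivAt
    have h0 : ∀ l, L (ridgeMap R k ⟨_, hcont⟩ l c) = 0 := fun l => ih hbk (fun s => rfl) l c
    have h1 : HasDerivAt (fun l => ridgeMap R k ⟨_, hcont⟩ l c) (ridgeMap R (k + 1) b' l c) l := by
      refine hasDerivAt_continuousMap (continuous_ridgeMap R (k + 1) b' (X := ℝ) continuous_id continuous_const)
        (fun s l => ?_) l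
      have h2 : HasDerivAt (fun l : ℝ => l * (s : ℝ) + c) (s : ℝ) l := by
        simpa using ((hasDerivAt_id l).mul_const (s : ℝ)).add_const c
      have h3 := ((hd (l * s + c)).comp l h2).const_mul ((s : ℝ) ^ k)
      exact h3.congr_deriv (by change _ = (s : ℝ) ^ (k + 1) * b' (l * s + c); ring)
    have h4 := L.hasFDerivAt.comp_hasDerivAt l h1
    have h5 : (⇑L ∘ fun l => ridgeMap R k ⟨_, hcont⟩ l c) = fun _ => (0 : Y) := funext h0
    rw [h5] at h4
    exact h4.unique (hasDerivAt_const l 0)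

/-- Repeated moving integrals of a bounded non-constant function `σ` gain arbitrarily many
derivatives, the highest of which is again bounded and non-constant. -/
theorem exists_smooth_annihilated [CompleteSpace Y] {σ : ℝ → ℝ} {τ : C(ℝ, ℝ)}
    (hσ : ContDiff ℝ 2 σ)
    (hτ : ∀ s, τ s = iteratedDeriv 2 σ s) (hσb : ∃ M : ℝ, ∀ s, |σ s| ≤ M)
    (hσc : ∃ a b, σ a ≠ σ b) (hL : ∀ l c, L (ridgeMap R 0 τ l c) = 0) (k : ℕ) :
    ∃ g : ℝ → ℝ, ContDiff ℝ (k + 2 : ℕ) g ∧ (∃ M : ℝ, ∀ s, |iteratedDeriv k g s| ≤ M) ∧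
      (∃ a b, iteratedDeriv k g a ≠ iteratedDeriv k g b) ∧
      ∀ b : C(ℝ, ℝ), (∀ s, b s = iteratedDeriv 2 g s) → ∀ l c, L (ridgeMap R 0 b l c) = 0 := by
  induction k with
  | zero =>
    refine ⟨σ, by simpa using hσ, by simpa using hσb, by simpa using hσc, fun b hb l c => ?_⟩
    have : b = τ := by ext s; rw [hb, hτ]
    rw [this]; exact hL l c
  | succ k ih =>
    obtain ⟨g, hg, ⟨M, hM⟩, hc, hann⟩ := ih
    obtain ⟨h, a, b, hab⟩ := exists_difference_nonconstant ⟨M, hM⟩ hc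
    have hgk : ContDiff ℝ k g := hg.of_le (by norm_cast; omega)
    have hit : ∀ s, iteratedDeriv (k + 1) (movingIntegral h g) s =
        iteratedDeriv k g (s + h) - iteratedDeriv k g s := by
      intro s
      rw [iteratedDeriv_succ', deriv_movingIntegral hg.continuous]
      have h1 : ContDiff ℝ k fun s => g (s + h) := by fun_prop
      have h2 := iteratedDeriv_sub (x := s) h1.contDiffAt hgk.contDiffAt
      rw [iteratedDeriv_comp_add_const] at h2
      exact h2
    refine ⟨movingIntegral h g, contDiff_movingIntegral hg h, ⟨M + M, fun s => ?_⟩,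
      ⟨a, b, by rwa [hit, hit]⟩, fun b' hb' l c => ?_⟩
    · rw [hit]
      exact (abs_sub _ _).trans (add_le_add (hM _) (hM _))
    · have hc2 : Continuous (iteratedDeriv 2 g) :=
        hg.continuous_iteratedDeriv 2 (by norm_cast; omega)
      -- The second derivative of the moving integral of `g` is the moving integral of `g''`, so
      -- annihilation passes on.
      refine map_ridgeMap_movingIntegral (b := ⟨_, hc2⟩) (h := h) (fun s => ?_)
        (hann _ fun s => rfl) l c
      have hg1 : Differentiable ℝ g := hg.differentiable (by norm_cast)
      have hd : ∀ s, HasDerivAt (deriv g) (iteratedDeriv 2 g s) s := by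
        intro s
        rw [iteratedDeriv_succ, iteratedDeriv_one]
        have := (hg.differentiable_iteratedDeriv 1 (by norm_cast; omega) s).hasDerivAt
        rwa [iteratedDeriv_one] at this
      rw [hb', iteratedDeriv_succ, iteratedDeriv_one, deriv_movingIntegral hg.continuous]
      have h1 : deriv (fun s => g (s + h) - g s) = fun s => deriv g (s + h) - deriv g s := by
        funext s
        exact (((hg1 (s + h)).hasDerivAt.comp_add_const s h).sub (hg1 s).hasDerivAt).deriv
      rw [h1, movingIntegral]
      have h2 := intervalIntegral.integral_eq_sub_of_hasDerivAt (a := 0) (b := h)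
        (fun y _ => (hd (s + y)).comp_const_add s y)
        ((hc2.comp (continuous_const.add continuous_id)).intervalIntegrable _ _)
      rw [add_zero] at h2
      exact h2.symm

/-- Values in a Banach space `Y`, rather than in `ℝ`, allow `L` to be a quotient map, so density
follows without Hahn–Banach. -/
theorem annihilator_eq_zero [CompleteSpace Y] {σ : ℝ → ℝ} {τ : C(ℝ, ℝ)} (hσ : ContDiff ℝ 2 σ)
    (hτ : ∀ s, τ s = iteratedDeriv 2 σ s) (hσb : ∃ M : ℝ, ∀ s, |σ s| ≤ M)
    (hσc : ∃ a b, σ a ≠ σ b) (hL : ∀ l c, L (ridgeMap R 0 τ l c) = 0) : L = 0 := by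
  have hmon : ∀ k : ℕ, L (ridgeMap R k 1 0 0) = 0 := by
    intro k
    -- The annihilated function is `g''`; its `k`-th derivative is the derivative of `g` of order `k
    -- + 2`, which is non-constant and hence nonzero at some `c`. At `l = 0` the ridge map is this
    -- number times `s ^ k`.
    obtain ⟨g, hg, -, ⟨a, b, hab⟩, hann⟩ := exists_smooth_annihilated hσ hτ hσb hσc hL (k + 2)
    obtain ⟨c, hc⟩ : ∃ c, iteratedDeriv (k + 2) g c ≠ 0 := by
      by_contra! H
      exact hab (by rw [H, H])
    have hc2 : Continuous (iteratedDeriv 2 g) :=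
      hg.continuous_iteratedDeriv 2 (by norm_cast; omega)
    have hck : Continuous (iteratedDeriv (k + 2) g) :=
      hg.continuous_iteratedDeriv (k + 2) (by norm_cast; omega)
    have hd : iteratedDeriv k (iteratedDeriv 2 g) = iteratedDeriv (k + 2) g := by
      rw [iteratedDeriv_eq_iterate, iteratedDeriv_eq_iterate, iteratedDeriv_eq_iterate,
        Function.iterate_add_apply]
    have hsm : ContDiff ℝ k (iteratedDeriv 2 g) := by
      rw [iteratedDeriv_eq_iterate]
      exact ContDiff.iterate_deriv' k 2 (hg.of_le (by norm_cast; omega))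
    have h := map_ridgeMap_iteratedDeriv (L := L) k (b := ⟨_, hc2⟩) (b' := ⟨_, hck⟩) hsm
      (fun s => by simp [hd]) (hann _ fun s => rfl) 0 c
    have he : ridgeMap R k ⟨_, hck⟩ 0 c = iteratedDeriv (k + 2) g c • ridgeMap R k 1 0 0 := by
      ext s
      simp [ridgeMap, mul_comm]
    rw [he, map_smul, smul_eq_zero] at h
    exact h.resolve_left hc
  have hker : ((polynomialFunctions (Icc (-R) R)).topologicalClosure : Set _) ⊆ {f | L f = 0} := by
    refine closure_minimal ?_ (isClosed_eq L.continuous continuous_const)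
    rintro _ ⟨p, -, rfl⟩
    change L (Polynomial.toContinuousMapOnAlgHom (Icc (-R) R) p) = 0
    induction p using Polynomial.induction_on' with
    | add p q hp hq =>
      rw [map_add, map_add, hp, hq, add_zero]
    | monomial n a =>
      have : Polynomial.toContinuousMapOnAlgHom (Icc (-R) R) (Polynomial.monomial n a) =
          a • ridgeMap R n 1 0 0 := by
        ext s
        simp [ridgeMap]
      rw [this, map_smul, hmon, smul_zero]
  rw [polynomialFunctions_closure_eq_top] at hker
  ext f
  exact hker (mem_univ f)

end Annihilator

/-! ### Approximation on the line with two derivatives -/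

/-- Finite linear combinations of the functions `s ↦ σ (l * s + c)`. -/
def ridgeSpan (σ : ℝ → ℝ) : Submodule ℝ (ℝ → ℝ) :=
  Submodule.span ℝ (range fun q : ℝ × ℝ => fun s => σ (q.1 * s + q.2))

theorem comp_affine_mem_ridgeSpan (σ : ℝ → ℝ) (l c : ℝ) :
    (fun s => σ (l * s + c)) ∈ ridgeSpan σ :=
  Submodule.subset_span ⟨(l, c), rfl⟩

theorem contDiff_of_mem_ridgeSpan {σ N : ℝ → ℝ} (hσ : ContDiff ℝ 2 σ) (hN : N ∈ ridgeSpan σ) :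
    ContDiff ℝ 2 N := by
  induction hN using Submodule.span_induction with
  | mem f hf =>
    obtain ⟨q, rfl⟩ := hf
    fun_prop
  | zero => exact contDiff_const
  | add f g _ _ hf hg => exact hf.add hg
  | smul a f _ hf => exact contDiff_const.smul hf

section SecondOrder

theorem hasDerivAt_deriv {f : ℝ → ℝ} (hf : ContDiff ℝ 2 f) (s : ℝ) :
    HasDerivAt f (deriv f s) s :=
  (hf.differentiable (by norm_num) s).hasDerivAt

theorem contDiff_deriv {f : ℝ → ℝ} (hf : ContDiff ℝ 2 f) : ContDiff ℝ 1 (deriv f) :=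
  ContDiff.iterate_deriv' 1 1 hf

theorem hasDerivAt_deriv_deriv {f : ℝ → ℝ} (hf : ContDiff ℝ 2 f) (s : ℝ) :
    HasDerivAt (deriv f) (deriv (deriv f) s) s :=
  ((contDiff_deriv hf).differentiable (by norm_num) s).hasDerivAt

theorem continuous_deriv_deriv {f : ℝ → ℝ} (hf : ContDiff ℝ 2 f) :
    Continuous (deriv (deriv f)) :=
  (contDiff_deriv hf).continuous_deriv le_rfl

theorem deriv_add_contDiff {f g : ℝ → ℝ} (hf : ContDiff ℝ 2 f) (hg : ContDiff ℝ 2 g) :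
    deriv (f + g) = deriv f + deriv g :=
  funext fun s => ((hasDerivAt_deriv hf s).add (hasDerivAt_deriv hg s)).deriv

theorem deriv_deriv_add {f g : ℝ → ℝ} (hf : ContDiff ℝ 2 f) (hg : ContDiff ℝ 2 g) :
    deriv (deriv (f + g)) = deriv (deriv f) + deriv (deriv g) := by
  rw [deriv_add_contDiff hf hg]
  exact funext fun s => ((hasDerivAt_deriv_deriv hf s).add (hasDerivAt_deriv_deriv hg s)).deriv

theorem deriv_deriv_smul {f : ℝ → ℝ} (hf : ContDiff ℝ 2 f) (a : ℝ) :
    deriv (deriv (a • f)) = a • deriv (deriv f) := by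
  have h1 : deriv (a • f) = a • deriv f :=
    funext fun s => ((hasDerivAt_deriv hf s).const_smul a).deriv
  rw [h1]
  exact funext fun s => ((hasDerivAt_deriv_deriv hf s).const_smul a).deriv

theorem hasDerivAt_affine (l c s : ℝ) : HasDerivAt (fun s => l * s + c) l s := by
  simpa using ((hasDerivAt_id s).const_mul l).add_const c

theorem deriv_comp_affine {f : ℝ → ℝ} (hf : Differentiable ℝ f) (l c : ℝ) :
    deriv (fun s => f (l * s + c)) = fun s => l * deriv f (l * s + c) := by
  funext s
  rw [mul_comm]
  exact ((hf (l * s + c)).hasDerivAt.comp s (hasDerivAt_affine l c s)).deriv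

theorem deriv_deriv_comp_affine {f : ℝ → ℝ} (hf : ContDiff ℝ 2 f) (l c : ℝ) :
    deriv (deriv fun s => f (l * s + c)) = fun s => l ^ 2 * deriv (deriv f) (l * s + c) := by
  rw [deriv_comp_affine (hf.differentiable (by norm_num))]
  have h1 := deriv_comp_affine ((contDiff_deriv hf).differentiable (by norm_num)) l c
  funext s
  have h2 : DifferentiableAt ℝ (fun s => deriv f (l * s + c)) s :=
    ((hasDerivAt_deriv_deriv hf _).comp s (hasDerivAt_affine l c s)).differentiableAt
  rw [deriv_const_mul _ h2, h1]
  ring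

/-- If two functions agree to first order at `0` and their second derivatives are `ε`-close on
`[-R, R]`, then so are the functions and their first derivatives, up to powers of `R`. -/
theorem abs_le_of_abs_deriv_deriv_le {f : ℝ → ℝ} (hf : ContDiff ℝ 2 f) (h0 : f 0 = 0)
    (h0' : deriv f 0 = 0) {R ε : ℝ} (h : ∀ s ∈ Icc (-R) R, |deriv (deriv f) s| ≤ ε) :
    ∀ s ∈ Icc (-R) R, |deriv f s| ≤ ε * R ∧ |f s| ≤ ε * R * R := by
  have key : ∀ (u : ℝ → ℝ) (δ : ℝ), Differentiable ℝ u → u 0 = 0 →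
      (∀ s ∈ Icc (-R) R, |deriv u s| ≤ δ) → ∀ s ∈ Icc (-R) R, |u s| ≤ δ * R := by
    intro u δ hu hu0 hd s hs
    have hR : 0 ≤ R := by linarith [hs.1, hs.2]
    have hδ : 0 ≤ δ := (abs_nonneg _).trans (hd s hs)
    have := (convex_Icc (-R) R).norm_image_sub_le_of_norm_deriv_le (f := u) (C := δ)
      (fun x _ => hu x) hd (x := 0) (y := s) ⟨by linarith, hR⟩ hs
    rw [hu0, sub_zero, sub_zero] at this
    exact this.trans (mul_le_mul_of_nonneg_left (abs_le.2 hs) hδ)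
  have h1 := key (deriv f) ε ((contDiff_deriv hf).differentiable (by norm_num)) h0' h
  exact fun s hs => ⟨h1 s hs, key f _ (hf.differentiable (by norm_num)) h0 h1 s hs⟩

end SecondOrder

variable {σ : ℝ → ℝ}

/-- The quotient map by the closed span of the functions `σ''(l s + c)` kills its own generators,
hence is zero, so the span is dense. -/
theorem exists_ridgeSpan_deriv_deriv_close (hσ : ContDiff ℝ 2 σ) (hσb : ∃ M : ℝ, ∀ s, |σ s| ≤ M)
    (hσc : ∃ a b, σ a ≠ σ b) (R : ℝ) (f : C(Icc (-R) R, ℝ)) {ε : ℝ} (hε : 0 < ε) :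
    ∃ N ∈ ridgeSpan σ, ∀ s : Icc (-R) R, |deriv (deriv N) s - f s| ≤ ε := by
  set τ : C(ℝ, ℝ) := ⟨deriv (deriv σ), continuous_deriv_deriv hσ⟩ with hτ
  set W : Submodule ℝ C(Icc (-R) R, ℝ) :=
    Submodule.span ℝ {u | ∃ l c, l ≠ 0 ∧ u = ridgeMap R 0 τ l c} with hW
  have hcl : IsClosed (W.topologicalClosure : Set C(Icc (-R) R, ℝ)) :=
    W.isClosed_topologicalClosure
  have hL : ∀ l c, W.topologicalClosure.mkQL (ridgeMap R 0 τ l c) = 0 := by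
    intro l c
    have hcont : Continuous fun l => W.topologicalClosure.mkQL (ridgeMap R 0 τ l c) :=
      W.topologicalClosure.mkQL.continuous.comp
        (continuous_ridgeMap R 0 τ continuous_id continuous_const)
    -- Only `l ≠ 0` is allowed in `W`, since `σ''(l s + c)` is the second derivative of `l⁻² σ(l s +
    -- c)`. The case `l = 0` follows by continuity in `l`.
    have heq : EqOn (fun l => W.topologicalClosure.mkQL (ridgeMap R 0 τ l c)) (fun _ => 0) {0}ᶜ := by
      intro l hl
      simp only [Submodule.mkQL_apply, Submodule.mkQ_apply, Submodule.Quotient.mk_eq_zero]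
      exact W.le_topologicalClosure (Submodule.subset_span ⟨l, c, hl, rfl⟩)
    exact congrFun (Continuous.ext_on (dense_compl_singleton (0 : ℝ)) hcont continuous_const heq) l
  have hzero : W.topologicalClosure.mkQL = 0 := by
    refine annihilator_eq_zero (Y := C(Icc (-R) R, ℝ) ⧸ W.topologicalClosure)
      (L := W.topologicalClosure.mkQL) hσ (τ := τ)
      (fun s => by rw [iteratedDeriv_succ, iteratedDeriv_one]; rfl) hσb hσc hL
  have hf : f ∈ W.topologicalClosure := by
    rw [← Submodule.Quotient.mk_eq_zero, ← Submodule.mkQ_apply, ← Submodule.mkQL_apply, hzero]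
    rfl
  obtain ⟨w, hwW, hw⟩ := Metric.mem_closure_iff.1 hf ε hε
  obtain ⟨N, hN, hNw⟩ : ∃ N ∈ ridgeSpan σ, ∀ s : Icc (-R) R, deriv (deriv N) s = w s := by
    clear hw
    induction hwW using Submodule.span_induction with
    | mem u hu =>
      obtain ⟨l, c, hl, rfl⟩ := hu
      refine ⟨(l ^ 2)⁻¹ • fun s => σ (l * s + c),
        Submodule.smul_mem _ _ (comp_affine_mem_ridgeSpan σ l c), fun s => ?_⟩
      rw [deriv_deriv_smul (by fun_prop), deriv_deriv_comp_affine hσ]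
      simp [ridgeMap, hτ, hl]
    | zero => exact ⟨0, Submodule.zero_mem _, fun s => by simp [Pi.zero_def]⟩
    | add u v _ _ hu hv =>
      obtain ⟨N, hN, h⟩ := hu
      obtain ⟨N', hN', h'⟩ := hv
      refine ⟨N + N', Submodule.add_mem _ hN hN', fun s => ?_⟩
      rw [deriv_deriv_add (contDiff_of_mem_ridgeSpan hσ hN) (contDiff_of_mem_ridgeSpan hσ hN')]
      simp [h, h']
    | smul a u _ hu =>
      obtain ⟨N, hN, h⟩ := hu
      refine ⟨a • N, Submodule.smul_mem _ _ hN, fun s => ?_⟩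
      rw [deriv_deriv_smul (contDiff_of_mem_ridgeSpan hσ hN)]
      simp [h]
  refine ⟨N, hN, fun s => ?_⟩
  rw [hNw, ← Real.dist_eq, dist_comm]
  exact (ContinuousMap.dist_apply_le_dist s).trans hw.le

/-- Zooming in where `σ' ≠ 0` makes `σ` nearly affine: `κ σ(h s + c₀)` with `κ h σ'(c₀) = b` has
slope `b` at `0`, while its second derivative carries a spare factor `h`. Constants come from weight
`l = 0` at a point where `σ ≠ 0`. -/
theorem exists_ridgeSpan_almost_affine (hσ : ContDiff ℝ 2 σ) (hσc : ∃ a b, σ a ≠ σ b)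
    (R a b : ℝ) {ε : ℝ} (hε : 0 < ε) :
    ∃ N ∈ ridgeSpan σ, N 0 = a ∧ deriv N 0 = b ∧
      ∀ s ∈ Icc (-R) R, |deriv (deriv N) s| ≤ ε := by
  obtain ⟨c₀, hc₀⟩ : ∃ c, deriv σ c ≠ 0 := by
    by_contra! H
    obtain ⟨a, b, hab⟩ := hσc
    exact hab (is_const_of_deriv_eq_zero (hσ.differentiable (by norm_num)) H a b)
  obtain ⟨c₁, hc₁⟩ : ∃ c, σ c ≠ 0 := by
    by_contra! H
    obtain ⟨a, b, hab⟩ := hσc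
    exact hab (by rw [H, H])
  obtain ⟨M, hM⟩ := (isCompact_Icc (a := -(|R| + |c₀|)) (b := |R| + |c₀|)).exists_bound_of_continuousOn
    (continuous_deriv_deriv hσ).continuousOn
  set B := |b / deriv σ c₀| * |M| with hB
  have hB0 : 0 ≤ B := by positivity
  obtain ⟨h, hh0, hh1, hhB⟩ : ∃ h : ℝ, 0 < h ∧ h ≤ 1 ∧ h * B ≤ ε := by
    refine ⟨min 1 (ε / (B + 1)), by positivity, min_le_left _ _, ?_⟩
    calc min 1 (ε / (B + 1)) * B ≤ ε / (B + 1) * (B + 1) := by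
          gcongr
          · exact min_le_right _ _
          · linarith
      _ = ε := by field_simp
  set κ := b / (deriv σ c₀ * h) with hκ
  have hlin := comp_affine_mem_ridgeSpan σ h c₀
  have hlinC := contDiff_of_mem_ridgeSpan hσ hlin
  have hlinS : ContDiff ℝ 2 (κ • fun s => σ (h * s + c₀)) := contDiff_const.smul hlinC
  have hconst : (fun _ => a - κ * σ c₀ : ℝ → ℝ) ∈ ridgeSpan σ := by
    have : (fun _ => a - κ * σ c₀ : ℝ → ℝ) =
        ((a - κ * σ c₀) / σ c₁) • fun s => σ (0 * s + c₁) := by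
      funext s
      simp [hc₁]
    rw [this]
    exact Submodule.smul_mem _ _ (comp_affine_mem_ridgeSpan σ 0 c₁)
  refine ⟨_, Submodule.add_mem _ hconst (Submodule.smul_mem _ κ hlin), ?_, ?_, fun s hs => ?_⟩
  · simp
  · rw [deriv_add_contDiff contDiff_const hlinS, Pi.add_apply, deriv_const,
      zero_add, ((hasDerivAt_deriv hlinC 0).const_smul κ).deriv,
      deriv_comp_affine (hσ.differentiable (by norm_num))]
    simp only [mul_zero, zero_add, hκ, smul_eq_mul]
    field_simp
  · rw [deriv_deriv_add contDiff_const hlinS, deriv_deriv_smul hlinC,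
      deriv_deriv_comp_affine hσ]
    have hs' : |s| ≤ |R| := (abs_le.2 hs).trans (le_abs_self R)
    have hmem : h * s + c₀ ∈ Icc (-(|R| + |c₀|)) (|R| + |c₀|) := by
      refine abs_le.1 ((abs_add_le _ _).trans (add_le_add ?_ le_rfl))
      rw [abs_mul, abs_of_pos hh0]
      nlinarith [abs_nonneg s]
    have h1 := (hM _ hmem).trans (le_abs_self M)
    rw [Real.norm_eq_abs] at h1
    have h2 : (deriv (deriv fun _ : ℝ => a - κ * σ c₀) +
        κ • fun s => h ^ 2 * deriv (deriv σ) (h * s + c₀)) s =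
        h * ((b / deriv σ c₀) * deriv (deriv σ) (h * s + c₀)) := by
      simp only [deriv_const', Pi.add_apply, Pi.smul_apply, smul_eq_mul, hκ]
      field_simp
      ring
    rw [h2, abs_mul, abs_mul, abs_of_pos hh0]
    refine le_trans ?_ hhB
    rw [hB]
    gcongr

/-- Universal approximation on the line, together with two derivatives. -/
theorem exists_ridgeSpan_close (hσ : ContDiff ℝ 2 σ) (hσb : ∃ M : ℝ, ∀ s, |σ s| ≤ M)
    (hσc : ∃ a b, σ a ≠ σ b) {G : ℝ → ℝ} (hG : ContDiff ℝ 2 G) (R : ℝ) {ε : ℝ} (hε : 0 < ε) :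
    ∃ N ∈ ridgeSpan σ, ∀ s ∈ Icc (-R) R, |N s - G s| ≤ ε ∧ |deriv N s - deriv G s| ≤ ε ∧
      |deriv (deriv N) s - deriv (deriv G) s| ≤ ε := by
  -- `N₀` and `N₁` each contribute `δ` to the second-derivative error; integrating from `0` once or
  -- twice costs a factor `R` or `R²`.
  obtain ⟨δ, hδ, h1, h2, h3⟩ : ∃ δ : ℝ, 0 < δ ∧ 2 * δ ≤ ε ∧ 2 * δ * R ≤ ε ∧ 2 * δ * R * R ≤ ε := by
    have hp : 0 < 2 * (1 + |R| + |R| * |R|) := by positivity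
    refine ⟨ε / (2 * (1 + |R| + |R| * |R|)), by positivity, ?_, ?_, ?_⟩
    all_goals
      have he : ε / (2 * (1 + |R| + |R| * |R|)) * (2 * (1 + |R| + |R| * |R|)) = ε := by field_simp
      have hq : 0 < ε / (2 * (1 + |R| + |R| * |R|)) := by positivity
      set q := ε / (2 * (1 + |R| + |R| * |R|))
      rw [← he]
    · nlinarith [abs_nonneg R, mul_nonneg (abs_nonneg R) (abs_nonneg R),
        mul_nonneg hq.le (abs_nonneg R), mul_nonneg hq.le (mul_self_nonneg (|R|))]
    · nlinarith [le_abs_self R, mul_le_mul_of_nonneg_left (le_abs_self R) hq.le,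
        mul_nonneg hq.le (mul_self_nonneg (|R|))]
    · rw [abs_mul_abs_self]
      nlinarith [mul_nonneg hq.le (abs_nonneg R)]
  obtain ⟨N₀, hN₀, h₀⟩ := exists_ridgeSpan_deriv_deriv_close hσ hσb hσc R
    ⟨fun s => deriv (deriv G) s, (continuous_deriv_deriv hG).comp continuous_subtype_val⟩ hδ
  obtain ⟨N₁, hN₁, ha, hb, h₁⟩ := exists_ridgeSpan_almost_affine hσ hσc R (G 0 - N₀ 0)
    (deriv G 0 - deriv N₀ 0) hδ
  have c0 := contDiff_of_mem_ridgeSpan hσ hN₀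
  have c1 := contDiff_of_mem_ridgeSpan hσ hN₁
  have c2 : ContDiff ℝ 2 ((-1 : ℝ) • G) := contDiff_const.smul hG
  have c01 : ContDiff ℝ 2 (N₀ + N₁) := c0.add c1
  have c012 : ContDiff ℝ 2 (N₀ + N₁ + (-1 : ℝ) • G) := c01.add c2
  have d2 : deriv ((-1 : ℝ) • G) = (-1 : ℝ) • deriv G :=
    funext fun s => ((hasDerivAt_deriv hG s).const_smul (-1 : ℝ)).deriv
  have hd : deriv (N₀ + N₁ + (-1 : ℝ) • G) = deriv N₀ + deriv N₁ + (-1 : ℝ) • deriv G := by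
    rw [deriv_add_contDiff c01 c2, deriv_add_contDiff c0 c1, d2]
  have hdd : deriv (deriv (N₀ + N₁ + (-1 : ℝ) • G)) =
      deriv (deriv N₀) + deriv (deriv N₁) + (-1 : ℝ) • deriv (deriv G) := by
    rw [deriv_deriv_add c01 c2, deriv_deriv_add c0 c1, deriv_deriv_smul hG]
  have hclose : ∀ s ∈ Icc (-R) R, |deriv (deriv (N₀ + N₁ + (-1 : ℝ) • G)) s| ≤ 2 * δ := by
    intro s hs
    have e1 := h₀ ⟨s, hs⟩
    have e2 := h₁ s hs
    simp only [ContinuousMap.coe_mk] at e1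
    rw [hdd]
    simp only [Pi.add_apply, Pi.smul_apply, smul_eq_mul]
    rw [abs_le] at *
    constructor <;> linarith [e1.1, e1.2, e2.1, e2.2]
  have hfin := abs_le_of_abs_deriv_deriv_le c012
    (by simp [ha]) (by rw [hd]; simp [hb]) hclose
  refine ⟨N₀ + N₁, Submodule.add_mem _ hN₀ hN₁, fun s hs => ⟨?_, ?_, ?_⟩⟩
  · have := (hfin s hs).2.trans h3
    simpa [← sub_eq_add_neg] using this
  · have := (hfin s hs).1.trans h2
    rw [hd] at this
    rw [deriv_add_contDiff c0 c1]
    simpa [← sub_eq_add_neg] using this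
  · have := (hclose s hs).trans h1
    rw [hdd] at this
    rw [deriv_deriv_add c0 c1]
    simpa [← sub_eq_add_neg] using this

/-! ### Elementary norm estimates -/

section NormedSpace

variable {E : Type*} [NormedAddCommGroup E]

theorem norm_add_sub_add_le (a b c e : E) : ‖a + b - (c + e)‖ ≤ ‖a - c‖ + ‖b - e‖ := by
  rw [add_sub_add_comm]
  exact norm_add_le _ _

theorem norm_sub_self_eq_zero (a : E) : ‖a - a‖ = 0 := by simp

variable [NormedSpace ℝ E]

theorem norm_smul_sub_smul (r : ℝ) (a b : E) : ‖r • a - r • b‖ = |r| * ‖a - b‖ := by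
  rw [← smul_sub, norm_smul, Real.norm_eq_abs]

theorem norm_smul_sub_smul_right (r s : ℝ) (a : E) : ‖r • a - s • a‖ = |r - s| * ‖a‖ := by
  rw [← sub_smul, norm_smul, Real.norm_eq_abs]

end NormedSpace

/-! ### Jets and their linearity -/

section Jets

variable {d : ℕ}

/-- Values of `(u, ∂_t u, ∇_x u, ∇_x² u)`. -/
abbrev Jet (d : ℕ) : Type := ℝ × ℝ × Space d × (Space d →L[ℝ] Space d)

/-- The derivatives `(u, ∂_t u, ∇_x u, ∇_x² u)` of `u` at `z`, one-sided in time at the endpoints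
of `[0, T]`. -/
def jet (T : ℝ) (u : ℝ → Space d → ℝ) (z : ℝ × Space d) : Jet d :=
  (u z.1 z.2, derivWithin (fun s => u s z.2) (Icc 0 T) z.1, gradient (u z.1) z.2,
    fderiv ℝ (gradient (u z.1)) z.2)

/-- The identification of linear forms on `ℝ^d` with vectors. -/
def rieszInv (d : ℕ) : (Space d →L[ℝ] ℝ) →L[ℝ] Space d where
  toFun := (InnerProductSpace.toDual ℝ (Space d)).symm
  map_add' := map_add _
  map_smul' r l := by simp
  cont := (InnerProductSpace.toDual ℝ (Space d)).symm.continuous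

theorem gradient_eq_rieszInv (f : Space d → ℝ) :
    gradient f = fun x => rieszInv d (fderiv ℝ f x) := rfl

theorem hasGradientAt_rieszInv {f : Space d → ℝ} {l : Space d →L[ℝ] ℝ} {x : Space d}
    (h : HasFDerivAt f l x) : HasGradientAt f (rieszInv d l) x :=
  hasFDerivAt_iff_hasGradientAt.1 h

variable {u v : ℝ → Space d → ℝ}

theorem contDiff_time (hu : ContDiff ℝ 2 (Function.uncurry u)) (x : Space d) :
    ContDiff ℝ 2 fun s => u s x :=
  hu.comp (contDiff_id.prodMk contDiff_const)

theorem contDiff_space (hu : ContDiff ℝ 2 (Function.uncurry u)) (t : ℝ) : ContDiff ℝ 2 (u t) :=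
  hu.comp (contDiff_const.prodMk contDiff_id)

theorem differentiable_fderiv {E : Type*} [NormedAddCommGroup E] [NormedSpace ℝ E] {f : E → ℝ}
    (hf : ContDiff ℝ 2 f) : Differentiable ℝ (fderiv ℝ f) :=
  (hf.fderiv_right (m := 1) (by norm_num)).differentiable (by norm_num)

theorem differentiable_gradient {f : Space d → ℝ} (hf : ContDiff ℝ 2 f) :
    Differentiable ℝ (gradient f) :=
  (rieszInv d).differentiable.comp (differentiable_fderiv hf)

theorem jet_add {T : ℝ} (hu : ContDiff ℝ 2 (Function.uncurry u))
    (hv : ContDiff ℝ 2 (Function.uncurry v)) (z : ℝ × Space d) :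
    jet T (u + v) z = jet T u z + jet T v z := by
  have hx : ∀ w : ℝ → Space d → ℝ, ContDiff ℝ 2 (Function.uncurry w) →
      Differentiable ℝ (w z.1) := fun w hw => (contDiff_space hw z.1).differentiable (by norm_num)
  have ht : ∀ w : ℝ → Space d → ℝ, ContDiff ℝ 2 (Function.uncurry w) →
      DifferentiableWithinAt ℝ (fun s => w s z.2) (Icc 0 T) z.1 := fun w hw =>
    ((contDiff_time hw z.2).differentiable (by norm_num) z.1).differentiableWithinAt
  have h1 : gradient ((u + v) z.1) = gradient (u z.1) + gradient (v z.1) := by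
    funext x
    simp only [gradient_eq_rieszInv, Pi.add_apply]
    rw [← map_add]
    exact congrArg _ (fderiv_add (hx u hu x) (hx v hv x))
  refine Prod.ext rfl (Prod.ext ?_ (Prod.ext ?_ ?_))
  · exact derivWithin_add (ht u hu) (ht v hv)
  · exact congrFun h1 z.2
  · change fderiv ℝ (gradient ((u + v) z.1)) z.2 = _
    rw [h1]
    exact fderiv_add (differentiable_gradient (contDiff_space hu _) _)
      (differentiable_gradient (contDiff_space hv _) _)

theorem jet_smul {T : ℝ} (hu : ContDiff ℝ 2 (Function.uncurry u)) (a : ℝ) (z : ℝ × Space d) :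
    jet T (a • u) z = a • jet T u z := by
  have h1 : gradient ((a • u) z.1) = a • gradient (u z.1) := by
    funext x
    simp only [gradient_eq_rieszInv, Pi.smul_apply]
    rw [← map_smul]
    exact congrArg _
      (fderiv_const_smul ((contDiff_space hu z.1).differentiable (by norm_num) x) a)
  refine Prod.ext rfl (Prod.ext ?_ (Prod.ext ?_ ?_))
  · exact derivWithin_const_smul a
      ((contDiff_time hu z.2).differentiable (by norm_num) z.1).differentiableWithinAt
  · exact congrFun h1 z.2
  · change fderiv ℝ (gradient ((a • u) z.1)) z.2 = _
    rw [h1]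
    exact fderiv_const_smul (differentiable_gradient (contDiff_space hu _) _) a

end Jets

/-! ### Jets of ridge functions -/

section RidgeFunctions

variable {d : ℕ} {T : ℝ}

/-- The ridge function `(t, x) ↦ G (L (t, x))`. -/
def ridgeFunction (G : ℝ → ℝ) (L : ℝ × Space d →L[ℝ] ℝ) (t : ℝ) (x : Space d) : ℝ := G (L (t, x))

theorem jet_ridgeFunction (hT : 0 < T) {G : ℝ → ℝ} (hG : ContDiff ℝ 2 G)
    (L : ℝ × Space d →L[ℝ] ℝ) {z : ℝ × Space d} (hz : z.1 ∈ Icc 0 T) :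
    jet T (ridgeFunction G L) z = (G (L z), L (1, 0) * deriv G (L z),
      deriv G (L z) • rieszInv d (L.comp (ContinuousLinearMap.inr ℝ ℝ (Space d))),
      deriv (deriv G) (L z) • (L.comp (ContinuousLinearMap.inr ℝ ℝ (Space d))).smulRight
        (rieszInv d (L.comp (ContinuousLinearMap.inr ℝ ℝ (Space d))))) := by
  set l := L.comp (ContinuousLinearMap.inr ℝ ℝ (Space d)) with hl
  have hx : ∀ t x, HasFDerivAt (fun y : Space d => L (t, y)) l x := fun t x =>
    L.hasFDerivAt.comp x (hasFDerivAt_prodMk_right t x)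
  have ht : HasDerivAt (fun s : ℝ => L (s, z.2)) (L (1, 0)) z.1 := by
    have := L.hasFDerivAt.comp_hasDerivAt z.1
      ((hasDerivAt_id z.1).prodMk (hasDerivAt_const z.1 z.2))
    exact this
  have h1 : gradient (ridgeFunction G L z.1) =
      fun x => deriv G (L (z.1, x)) • rieszInv d l := by
    funext x
    rw [gradient_eq_rieszInv, ← map_smul]
    exact congrArg _ ((hasDerivAt_deriv hG _).comp_hasFDerivAt x (hx z.1 x)).fderiv
  refine Prod.ext rfl (Prod.ext ?_ (Prod.ext ?_ ?_))
  · have := (((hasDerivAt_deriv hG (L (z.1, z.2))).comp z.1 ht).hasDerivWithinAt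
      (s := Icc 0 T)).derivWithin (uniqueDiffOn_Icc hT z.1 hz)
    exact this.trans (mul_comm _ _)
  · exact congrFun h1 z.2
  · change fderiv ℝ (gradient (ridgeFunction G L z.1)) z.2 = _
    rw [h1]
    have := (((hasDerivAt_deriv_deriv hG (L (z.1, z.2))).comp_hasFDerivAt z.2
      (hx z.1 z.2)).smul_const (rieszInv d l)).fderiv
    refine this.trans ?_
    ext a b
    simp [mul_assoc]

theorem contDiff_ridgeFunction {G : ℝ → ℝ} (hG : ContDiff ℝ 2 G) (L : ℝ × Space d →L[ℝ] ℝ) :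
    ContDiff ℝ 2 (Function.uncurry (ridgeFunction G L)) :=
  hG.comp L.contDiff

end RidgeFunctions

/-! ### Networks as a vector space containing ridge functions -/

section NetworkAlgebra

variable {d : ℕ} {σ : ℝ → ℝ}

theorem networks_add {f g : ℝ → Space d → ℝ} (hf : f ∈ Networks d σ) (hg : g ∈ Networks d σ) :
    f + g ∈ Networks d σ := by
  obtain ⟨n, hn, β, a, w, c, rfl⟩ := hf
  obtain ⟨m, hm, β', a', w', c', rfl⟩ := hg
  refine ⟨n + m, by omega, Fin.append β β', Fin.append a a', Fin.append w w', Fin.append c c', ?_⟩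
  funext t x
  simp [Fin.sum_univ_add]

theorem networks_smul {f : ℝ → Space d → ℝ} (hf : f ∈ Networks d σ) (r : ℝ) :
    r • f ∈ Networks d σ := by
  obtain ⟨n, hn, β, a, w, c, rfl⟩ := hf
  refine ⟨n, hn, fun i => r * β i, a, w, c, ?_⟩
  funext t x
  simp [Finset.mul_sum, mul_assoc]

theorem networks_zero : (0 : ℝ → Space d → ℝ) ∈ Networks d σ :=
  ⟨1, le_rfl, 0, 0, 0, 0, by funext t x; simp⟩

theorem networks_contDiff (hσ : ContDiff ℝ 2 σ) {f : ℝ → Space d → ℝ} (hf : f ∈ Networks d σ) :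
    ContDiff ℝ 2 (Function.uncurry f) := by
  obtain ⟨n, -, β, a, w, c, rfl⟩ := hf
  simp only [Function.uncurry_def]
  fun_prop

theorem ridgeFunction_mem_networks {N : ℝ → ℝ} (hN : N ∈ ridgeSpan σ)
    (L : ℝ × Space d →L[ℝ] ℝ) : ridgeFunction N L ∈ Networks d σ := by
  induction hN using Submodule.span_induction with
  | mem f hf =>
    obtain ⟨q, rfl⟩ := hf
    refine ⟨1, le_rfl, fun _ => 1, fun _ => q.1 * L (1, 0),
      fun _ j => q.1 * L (0, EuclideanSpace.single j 1), fun _ => q.2, ?_⟩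
    funext t x
    have hx : x = ∑ j, x j • EuclideanSpace.single j (1 : ℝ) := by
      ext i
      simp [Finset.sum_apply, Pi.single_apply]
    have h1 : L (t, x) = t * L (1, 0) + ∑ j, x j * L (0, EuclideanSpace.single j 1) := by
      have h2 : L (t, x) = L (t • (1, 0)) + L.comp (ContinuousLinearMap.inr ℝ ℝ (Space d)) x := by
        rw [ContinuousLinearMap.comp_apply, ← map_add]
        simp
      rw [h2]
      conv_lhs => rw [hx]
      simp only [map_sum, map_smul, smul_eq_mul]
      rfl
    simp only [ridgeFunction, h1, Finset.univ_unique, Finset.sum_const, Finset.card_singleton,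
      one_smul, one_mul]
    congr 1
    rw [mul_add, Finset.mul_sum]
    congr 2
    · ring
    · exact Finset.sum_congr rfl fun j _ => by ring
  | zero => exact networks_zero
  | add f g _ _ hf hg => exact networks_add hf hg
  | smul r f _ hf => exact networks_smul hf r

end NetworkAlgebra

/-! ### Limits of networks in `C^{1,2}` -/

section Closure

variable {d : ℕ} {σ : ℝ → ℝ} {T : ℝ} {Ω : Set (Space d)}

/-- `f` is `C²` and a limit of networks, uniformly on `[0, T] × Ω` with one time and two space
derivatives. -/
def IsNetworkLimit (σ : ℝ → ℝ) (T : ℝ) (Ω : Set (Space d)) (f : ℝ → Space d → ℝ) : Prop :=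
  ContDiff ℝ 2 (Function.uncurry f) ∧ ∀ ε > 0, ∃ N ∈ Networks d σ,
    ∀ z ∈ Icc 0 T ×ˢ Ω, ‖jet T N z - jet T f z‖ ≤ ε

theorem IsNetworkLimit.add (hσ : ContDiff ℝ 2 σ) {f g : ℝ → Space d → ℝ}
    (hf : IsNetworkLimit σ T Ω f) (hg : IsNetworkLimit σ T Ω g) :
    IsNetworkLimit σ T Ω (f + g) := by
  refine ⟨hf.1.add hg.1, fun ε hε => ?_⟩
  obtain ⟨N, hN, h⟩ := hf.2 (ε / 2) (half_pos hε)
  obtain ⟨N', hN', h'⟩ := hg.2 (ε / 2) (half_pos hε)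
  refine ⟨N + N', networks_add hN hN', fun z hz => ?_⟩
  rw [jet_add (networks_contDiff hσ hN) (networks_contDiff hσ hN'), jet_add hf.1 hg.1]
  exact (norm_add_sub_add_le (E := Jet d) _ _ _ _).trans (by linarith [h z hz, h' z hz])

theorem IsNetworkLimit.smul (hσ : ContDiff ℝ 2 σ) {f : ℝ → Space d → ℝ}
    (hf : IsNetworkLimit σ T Ω f) (a : ℝ) : IsNetworkLimit σ T Ω (a • f) := by
  have hc : ContDiff ℝ 2 (a • Function.uncurry f) := contDiff_const.smul hf.1
  refine ⟨hc, fun ε hε => ?_⟩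
  obtain ⟨N, hN, h⟩ := hf.2 (ε / (|a| + 1)) (by positivity)
  refine ⟨a • N, networks_smul hN a, fun z hz => ?_⟩
  rw [jet_smul (networks_contDiff hσ hN), jet_smul hf.1]
  refine (norm_smul_sub_smul (E := Jet d) a _ _).le.trans ?_
  calc |a| * ‖jet T N z - jet T f z‖ ≤ (|a| + 1) * (ε / (|a| + 1)) := by
        gcongr
        · linarith
        · exact h z hz
    _ = ε := by field_simp

theorem isNetworkLimit_zero : IsNetworkLimit σ T Ω 0 :=
  ⟨contDiff_const, fun _ hε => ⟨0, networks_zero, fun _ _ =>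
    (norm_sub_self_eq_zero (E := Jet d) _).le.trans hε.le⟩⟩

theorem isNetworkLimit_ridgeFunction (hσ : ContDiff ℝ 2 σ) (hσb : ∃ M : ℝ, ∀ s, |σ s| ≤ M)
    (hσc : ∃ a b, σ a ≠ σ b) (hT : 0 < T) (hΩ : IsCompact Ω) {G : ℝ → ℝ} (hG : ContDiff ℝ 2 G)
    (L : ℝ × Space d →L[ℝ] ℝ) : IsNetworkLimit σ T Ω (ridgeFunction G L) := by
  refine ⟨contDiff_ridgeFunction hG L, fun ε hε => ?_⟩
  obtain ⟨R, hR⟩ := (isCompact_Icc (a := 0) (b := T)).prod hΩ |>.exists_bound_of_continuousOn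
    L.continuous.continuousOn
  set l := L.comp (ContinuousLinearMap.inr ℝ ℝ (Space d)) with hl
  set w := rieszInv d l
  -- The jet of `G ∘ L` is `G`, `G'`, `G'`, `G''` times fixed coefficients, and `C` dominates all
  -- four of their norms.
  set C : ℝ := 1 + |L (1, 0)| + ‖w‖ + ‖l.smulRight w‖ with hC
  have hC0 : 0 < C := by positivity
  obtain ⟨N, hN, h⟩ := exists_ridgeSpan_close hσ hσb hσc hG R (ε := ε / C) (by positivity)
  refine ⟨ridgeFunction N L, ridgeFunction_mem_networks hN L, fun z hz => ?_⟩
  rw [jet_ridgeFunction hT (contDiff_of_mem_ridgeSpan hσ hN) L hz.1, jet_ridgeFunction hT hG L hz.1]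
  obtain ⟨h0, h1, h2⟩ := h (L z) (abs_le.1 (hR z hz))
  have hle : ∀ c : ℝ, c ≤ C → ε / C * c ≤ ε := fun c hc => by
    calc ε / C * c ≤ ε / C * C := by gcongr
      _ = ε := by field_simp
  have ha := abs_nonneg (L (1, 0))
  have hb := norm_nonneg w
  have hc := norm_nonneg (l.smulRight w)
  simp only [Prod.mk_sub_mk, ← mul_sub, norm_prod_le_iff, norm_mul, Real.norm_eq_abs]
  refine ⟨?_, ?_, ?_, ?_⟩
  · exact h0.trans ((mul_one _).symm.le.trans (hle 1 (by linarith)))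
  · rw [mul_comm]
    exact (mul_le_mul_of_nonneg_right h1 ha).trans (hle _ (by linarith))
  · exact (norm_smul_sub_smul_right _ _ w).le.trans <| (mul_le_mul_of_nonneg_right h1 hb).trans (hle _ (by linarith))
  · exact (norm_smul_sub_smul_right _ _ (l.smulRight w)).le.trans <| (mul_le_mul_of_nonneg_right h2 hc).trans (hle _ (by linarith))

end Closure

/-! ### Sums of exponentials -/

section Exponentials

variable {V : Type*} [NormedAddCommGroup V] [NormedSpace ℝ V]

/-- Finite linear combinations of the exponentials of continuous linear forms. -/
def expSpan (V : Type*) [NormedAddCommGroup V] [NormedSpace ℝ V] : Submodule ℝ (V → ℝ) :=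
  Submodule.span ℝ (range fun L : V →L[ℝ] ℝ => fun z => Real.exp (L z))

theorem exp_mem_expSpan (L : V →L[ℝ] ℝ) : (fun z => Real.exp (L z)) ∈ expSpan V :=
  Submodule.subset_span ⟨L, rfl⟩

theorem one_mem_expSpan : (1 : V → ℝ) ∈ expSpan V := by
  convert exp_mem_expSpan (0 : V →L[ℝ] ℝ) using 1
  ext z
  simp

theorem mul_mem_expSpan {p q : V → ℝ} (hp : p ∈ expSpan V) (hq : q ∈ expSpan V) :
    p * q ∈ expSpan V := by
  have h := Submodule.mul_mem_mul hp hq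
  rw [expSpan, Submodule.span_mul_span] at h
  refine Submodule.span_le.2 ?_ h
  rintro _ ⟨_, ⟨L, rfl⟩, _, ⟨M, rfl⟩, rfl⟩
  have : (fun z => Real.exp (L z)) * (fun z => Real.exp (M z)) =
      fun z => Real.exp ((L + M) z) := by
    ext z
    simp [Real.exp_add]
  have h2 := exp_mem_expSpan (L + M)
  rwa [← this] at h2

theorem pow_mem_expSpan {p : V → ℝ} (hp : p ∈ expSpan V) (n : ℕ) : p ^ n ∈ expSpan V := by
  induction n with
  | zero => simpa using one_mem_expSpan
  | succ n ih => rw [pow_succ]; exact mul_mem_expSpan ih hp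

theorem continuous_of_mem_expSpan {p : V → ℝ} (hp : p ∈ expSpan V) : Continuous p := by
  induction hp using Submodule.span_induction with
  | mem f hf => obtain ⟨L, rfl⟩ := hf; fun_prop
  | zero => exact continuous_const
  | add f g _ _ hf hg => exact hf.add hg
  | smul a f _ hf => exact continuous_const.smul hf

/-- Since `exp (L (z - y)) = exp (L z) * exp (-L y)`, convolution only multiplies each exponential
by a constant. -/
theorem convolution_mem_expSpan [MeasurableSpace V] [BorelSpace V] {μ : Measure V}
    [IsFiniteMeasureOnCompacts μ] {f : V → ℝ} (hf : Continuous f) (hfc : HasCompactSupport f)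
    {p : V → ℝ} (hp : p ∈ expSpan V) : (fun z => ∫ y, p (z - y) * f y ∂μ) ∈ expSpan V := by
  have hint : ∀ q ∈ expSpan V, ∀ z, Integrable (fun y => q (z - y) * f y) μ := fun q hq z =>
    (((continuous_of_mem_expSpan hq).comp (continuous_const.sub continuous_id)).mul
      hf).integrable_of_hasCompactSupport hfc.mul_left
  induction hp using Submodule.span_induction with
  | mem q hq =>
    obtain ⟨L, rfl⟩ := hq
    have : (fun z => ∫ y, Real.exp (L (z - y)) * f y ∂μ) =
        (∫ y, Real.exp (-L y) * f y ∂μ) • fun z => Real.exp (L z) := by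
      ext z
      have h1 : ∀ y, Real.exp (L (z - y)) * f y = Real.exp (L z) * (Real.exp (-L y) * f y) :=
        fun y => by rw [map_sub, sub_eq_add_neg, Real.exp_add, mul_assoc]
      simp only [h1, integral_const_mul, Pi.smul_apply, smul_eq_mul]
      ring
    rw [this]
    exact Submodule.smul_mem _ _ (exp_mem_expSpan L)
  | zero =>
    convert Submodule.zero_mem (expSpan V) using 1
    ext z
    simp
  | add q r hq hr ihq ihr =>
    convert Submodule.add_mem _ ihq ihr using 1
    ext z
    rw [Pi.add_apply, ← integral_add (hint q hq z) (hint r hr z)]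
    simp [add_mul]
  | smul a q hq ih =>
    convert Submodule.smul_mem _ a ih using 1
    ext z
    rw [Pi.smul_apply, smul_eq_mul, ← integral_const_mul]
    simp [mul_assoc]

/-- On a compact set there is a nonnegative combination of exponentials with a strict maximum at
the origin. -/
theorem exists_expSpan_peak [FiniteDimensional ℝ V] {s : Set V} (hs : IsCompact s) :
    ∃ c ∈ expSpan V, (∀ y, y ≠ 0 → c y < c 0) ∧ (∀ y ∈ s, 0 ≤ c y) ∧ 0 < c 0 := by
  set b := Module.finBasis ℝ V
  set Λ : Fin (Module.finrank ℝ V) → V →L[ℝ] ℝ := fun i =>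
    LinearMap.toContinuousLinearMap (b.coord i) with hΛ
  set e : V → ℝ := fun y => ∑ i, Real.cosh (Λ i y) with he
  have hemem : e ∈ expSpan V := by
    have h1 : e = ∑ i, (1 / 2 : ℝ) •
        ((fun z => Real.exp (Λ i z)) + fun z => Real.exp ((-Λ i) z)) := by
      ext y
      simp [he, Real.cosh_eq, div_eq_inv_mul, mul_add]
    rw [h1]
    exact Submodule.sum_mem _ fun i _ => Submodule.smul_mem _ _
      (Submodule.add_mem _ (exp_mem_expSpan _) (exp_mem_expSpan _))
  obtain ⟨M, hM⟩ := hs.exists_bound_of_continuousOn (continuous_of_mem_expSpan hemem).continuousOn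
  have hpk : ∀ y, y ≠ 0 → e 0 < e y := by
    intro y hy
    obtain ⟨i, hi⟩ : ∃ i, b.coord i y ≠ 0 := by
      by_contra! H
      exact hy (b.forall_coord_eq_zero_iff.1 H)
    refine Finset.sum_lt_sum (fun i _ => ?_) ⟨i, Finset.mem_univ i, ?_⟩
    · simp
    · simpa [hΛ] using hi
  -- The sum `e` of hyperbolic cosines of coordinates has a strict minimum at `0`; it is subtracted
  -- from a constant exceeding its bound on `s`.
  refine ⟨(|M| + e 0 + 1) • (1 : V → ℝ) - e,
    Submodule.sub_mem _ (Submodule.smul_mem _ _ one_mem_expSpan) hemem, fun y hy => ?_,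
    fun y hy => ?_, ?_⟩
  · have := hpk y hy
    simpa using this
  · have h1 : 0 ≤ e 0 := Finset.sum_nonneg fun i _ => by simp
    have h2 := (le_abs_self _).trans ((hM y hy).trans (le_abs_self M))
    simp only [Pi.sub_apply, Pi.smul_apply, Pi.one_apply, smul_eq_mul, mul_one]
    linarith
  · simp only [Pi.sub_apply, Pi.smul_apply, Pi.one_apply, smul_eq_mul, mul_one]
    linarith [abs_nonneg M]

end Exponentials

/-! ### Differentiation under the integral sign over a compact set -/

section ParametricIntegrals

variable {α : Type*} [TopologicalSpace α] [MeasurableSpace α] [OpensMeasurableSpace α]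
  [T2Space α] {μ : Measure α} [IsFiniteMeasureOnCompacts μ] {s : Set α}
  {W : Type*} [NormedAddCommGroup W] [NormedSpace ℝ W]

theorem hasFDerivAt_setIntegral_of_continuous {X : Type*} [NormedAddCommGroup X] [NormedSpace ℝ X]
    [ProperSpace X] (hs : IsCompact s) {g : X → α → W} {g' : X → α → X →L[ℝ] W}
    (hg : Continuous (Function.uncurry g)) (hg' : Continuous (Function.uncurry g'))
    (hd : ∀ x a, HasFDerivAt (fun x => g x a) (g' x a) x) (x : X) :
    HasFDerivAt (fun x => ∫ a in s, g x a ∂μ) (∫ a in s, g' x a ∂μ) x := by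
  obtain ⟨C, hC⟩ := ((isCompact_closedBall x 1).prod hs).exists_bound_of_continuousOn
    hg'.continuousOn
  have hgx : ∀ x, Continuous (g x) := fun x => hg.comp (Continuous.prodMk_right x)
  have hgx' : Continuous (g' x) := hg'.comp (Continuous.prodMk_right x)
  refine hasFDerivAt_integral_of_dominated_of_fderiv_le (bound := fun _ => C)
    (Metric.closedBall_mem_nhds x one_pos)
    (Filter.Eventually.of_forall fun x => ((hgx x).continuousOn.integrableOn_compact
      hs).aestronglyMeasurable)
    ((hgx x).continuousOn.integrableOn_compact hs)
    (hgx'.continuousOn.integrableOn_compact hs).aestronglyMeasurable ?_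
    (continuousOn_const.integrableOn_compact hs)
    (Filter.Eventually.of_forall fun a x _ => hd x a)
  filter_upwards [ae_restrict_mem hs.measurableSet] with a ha y hy
  exact hC (y, a) ⟨hy, ha⟩

theorem hasDerivAt_setIntegral_of_continuous (hs : IsCompact s) {g g' : ℝ → α → W}
    (hg : Continuous (Function.uncurry g)) (hg' : Continuous (Function.uncurry g'))
    (hd : ∀ x a, HasDerivAt (fun x => g x a) (g' x a) x) (x : ℝ) :
    HasDerivAt (fun x => ∫ a in s, g x a ∂μ) (∫ a in s, g' x a ∂μ) x := by
  obtain ⟨C, hC⟩ := ((isCompact_closedBall x 1).prod hs).exists_bound_of_continuousOn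
    hg'.continuousOn
  have hgx : ∀ x, Continuous (g x) := fun x => hg.comp (Continuous.prodMk_right x)
  have hgx' : Continuous (g' x) := hg'.comp (Continuous.prodMk_right x)
  refine (hasDerivAt_integral_of_dominated_loc_of_deriv_le (bound := fun _ => C)
    (Metric.closedBall_mem_nhds x one_pos)
    (Filter.Eventually.of_forall fun x => ((hgx x).continuousOn.integrableOn_compact
      hs).aestronglyMeasurable)
    ((hgx x).continuousOn.integrableOn_compact hs)
    (hgx'.continuousOn.integrableOn_compact hs).aestronglyMeasurable ?_
    (continuousOn_const.integrableOn_compact hs)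
    (Filter.Eventually.of_forall fun a x _ => hd x a)).2
  filter_upwards [ae_restrict_mem hs.measurableSet] with a ha y hy
  exact hC (y, a) ⟨hy, ha⟩

end ParametricIntegrals

/-! ### Mollification by powers of an exponential sum -/

section Mollification

theorem hasFDerivAt_comp_sub_const {E F : Type*} [NormedAddCommGroup E] [NormedSpace ℝ E]
    [NormedAddCommGroup F] [NormedSpace ℝ F] {f : E → F} {f' : E →L[ℝ] F} {x a : E}
    (h : HasFDerivAt f f' (x - a)) : HasFDerivAt (fun y => f (y - a)) f' x :=
  h.comp x ((hasFDerivAt_id x).sub_const a)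

variable {d : ℕ}

/-- `j` is continuous and consists of a function on `ℝ × ℝ^d`, its time derivative and its first
two space derivatives. -/
structure IsJetField (j : ℝ × Space d → Jet d) : Prop where
  continuous : Continuous j
  time : ∀ z, HasDerivAt (fun s => (j (s, z.2)).1) (j z).2.1 z.1
  space : ∀ z, HasGradientAt (fun y => (j (z.1, y)).1) (j z).2.2.1 z.2
  space_space : ∀ z, HasFDerivAt (fun y => (j (z.1, y)).2.2.1) (j z).2.2.2 z.2

theorem IsJetField.jet_eq {j : ℝ × Space d → Jet d} (hj : IsJetField j) {T : ℝ} (hT : 0 < T)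
    {O : Set (ℝ × Space d)} (hO : IsOpen O) {u : ℝ → Space d → ℝ}
    (hu : ∀ z ∈ O, u z.1 z.2 = (j z).1) {z : ℝ × Space d} (hz : z ∈ O) (hzT : z.1 ∈ Icc 0 T) :
    jet T u z = j z := by
  have hev : ∀ᶠ w in nhds z, w ∈ O := hO.mem_nhds hz
  have ht : ∀ᶠ s in nhds z.1, (s, z.2) ∈ O :=
    (Continuous.prodMk_left z.2).continuousAt.eventually hev
  have hx : ∀ᶠ y in nhds z.2, (z.1, y) ∈ O :=
    (Continuous.prodMk_right z.1).continuousAt.eventually hev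
  have h1 : ∀ y, (z.1, y) ∈ O → HasGradientAt (u z.1) (j (z.1, y)).2.2.1 y := by
    intro y hy
    refine HasFDerivAt.congr_of_eventuallyEq (hj.space (z.1, y)) ?_
    filter_upwards [(Continuous.prodMk_right z.1).continuousAt.eventually (hO.mem_nhds hy)] with
      w hw using hu (z.1, w) hw
  refine Prod.ext (hu z hz) (Prod.ext ?_ (Prod.ext ?_ ?_))
  · refine HasDerivWithinAt.derivWithin ?_ (uniqueDiffOn_Icc hT z.1 hzT)
    refine ((hj.time z).congr_of_eventuallyEq ?_).hasDerivWithinAt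
    filter_upwards [ht] with s hs using hu (s, z.2) hs
  · exact (h1 z.2 hz).gradient
  · refine HasFDerivAt.fderiv ((hj.space_space z).congr_of_eventuallyEq ?_)
    filter_upwards [hx] with y hy using (h1 y hy).gradient

/-- Averaging the translates of a jet field gives a jet field. -/
theorem IsJetField.average {j : ℝ × Space d → Jet d} (hj : IsJetField j)
    {s : Set (ℝ × Space d)} (hs : IsCompact s) {p : ℝ × Space d → ℝ} (hp : Continuous p) (m : ℝ) :
    IsJetField fun z => m • ∫ y in s, p y • j (z - y) := by
  have hjc := hj.continuous
  have hcont : Continuous (Function.uncurry fun z y => p y • j (z - y)) := by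
    simp only [Function.uncurry_def]
    fun_prop
  have hint : ∀ z, IntegrableOn (fun y => p y • j (z - y)) s := fun z =>
    (hcont.comp (Continuous.prodMk_right z)).continuousOn.integrableOn_compact hs
  have e1 : ∀ z, (m • ∫ y in s, p y • j (z - y)).1 = m • ∫ y in s, p y • (j (z - y)).1 :=
    fun z => by rw [Prod.smul_fst, fst_integral (hint z)]; rfl
  have e2 : ∀ z, (m • ∫ y in s, p y • j (z - y)).2.1 = m • ∫ y in s, p y • (j (z - y)).2.1 :=
    fun z => by
      rw [Prod.smul_snd, Prod.smul_fst, snd_integral (hint z), fst_integral (hint z).snd]; rfl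
  have e3 : ∀ z, (m • ∫ y in s, p y • j (z - y)).2.2.1 = m • ∫ y in s, p y • (j (z - y)).2.2.1 :=
    fun z => by
      rw [Prod.smul_snd, Prod.smul_snd, Prod.smul_fst, snd_integral (hint z),
        snd_integral (hint z).snd, fst_integral (hint z).snd.snd]; rfl
  have e4 : ∀ z, (m • ∫ y in s, p y • j (z - y)).2.2.2 = m • ∫ y in s, p y • (j (z - y)).2.2.2 :=
    fun z => by
      rw [Prod.smul_snd, Prod.smul_snd, Prod.smul_snd, snd_integral (hint z),
        snd_integral (hint z).snd, snd_integral (hint z).snd.snd]; rfl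
  refine ⟨?_, fun z => ?_, fun z => ?_, fun z => ?_⟩
  · exact (continuous_parametric_integral_of_continuous hcont hs).const_smul m
  · simp only [e1, e2]
    refine (hasDerivAt_setIntegral_of_continuous (μ := volume) hs
      (g := fun t y => p y • (j ((t, z.2) - y)).1)
      (g' := fun t y => p y • (j ((t, z.2) - y)).2.1) (by fun_prop) (by fun_prop)
      (fun t y => ?_) z.1).const_smul m
    exact ((hj.time ((t, z.2) - y)).comp_sub_const t y.1).const_smul (p y)
  · simp only [e1, e3]
    have h := (hasFDerivAt_setIntegral_of_continuous (μ := volume) hs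
      (g := fun x y => p y • (j ((z.1, x) - y)).1)
      (g' := fun x y => innerSL ℝ (p y • (j ((z.1, x) - y)).2.2.1)) (by fun_prop) (by fun_prop)
      (fun x y => ?_) z.2).const_smul m
    · have h1 := (innerSL ℝ (E := Space d)).integral_comp_comm (hint z).snd.snd.fst
      refine HasFDerivAt.congr_fderiv h ?_
      refine (congrArg (m • ·) h1).trans ?_
      rw [← map_smul]
      rfl
    · rw [map_smul]
      exact (hasFDerivAt_comp_sub_const (hj.space ((z.1, x) - y))).const_smul (p y)
  · simp only [e3, e4]
    have h := (hasFDerivAt_setIntegral_of_continuous (μ := volume) hs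
      (g := fun x y => p y • (j ((z.1, x) - y)).2.2.1)
      (g' := fun x y => p y • (j ((z.1, x) - y)).2.2.2) (by fun_prop) (by fun_prop)
      (fun x y => ?_) z.2).const_smul m
    · exact h
    · exact (hasFDerivAt_comp_sub_const (hj.space_space ((z.1, x) - y))).const_smul (p y)

/-- A compactly supported function of class `C^{1,2}` is approximated by sums of exponentials. -/
theorem IsJetField.exists_expSpan_close {j : ℝ × Space d → Jet d} (hj : IsJetField j)
    (hjc : HasCompactSupport fun z => (j z).1) {T : ℝ} (hT : 0 < T) {Ω : Set (Space d)}
    (hΩ : IsCompact Ω) {ε : ℝ} (hε : 0 < ε) :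
    ∃ Q ∈ expSpan (ℝ × Space d), ∀ z ∈ Icc 0 T ×ˢ Ω, ‖jet T (Function.curry Q) z - j z‖ ≤ ε := by
  have hE : IsCompact (Icc 0 T ×ˢ Ω) := isCompact_Icc.prod hΩ
  obtain ⟨r, hr⟩ := (hE.isBounded.union hjc.isBounded).subset_ball 0
  -- The ball of radius `R` holds both `[0, T] × Ω` and the support. For `w` in it and `y` outside
  -- the ball of radius `2R`, the point `w - y` misses the support, so integrating over `s` loses
  -- nothing.
  set R := max r 1 with hR
  have hR0 : 0 < R := lt_max_of_lt_right one_pos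
  have hsub := hr.trans (Metric.ball_subset_ball (le_max_left r 1))
  set s := Metric.closedBall (0 : ℝ × Space d) (2 * R) with hs
  have hsc : IsCompact s := isCompact_closedBall _ _
  obtain ⟨c, hc, hmax, hnn, hpos⟩ := exists_expSpan_peak hsc
  have hcc := continuous_of_mem_expSpan hc
  have : CompactSpace (Icc 0 T ×ˢ Ω : Set (ℝ × Space d)) := isCompact_iff_compactSpace.1 hE
  set g : ℝ × Space d → C((Icc 0 T ×ˢ Ω : Set (ℝ × Space d)), Jet d) := fun y =>
    ⟨fun z => j (z - y), hj.continuous.comp (by fun_prop)⟩ with hg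
  have hgc : Continuous g := by
    refine ContinuousMap.continuous_of_continuous_uncurry _ ?_
    exact hj.continuous.comp (by fun_prop)
  -- The normalized powers `c ^ n` concentrate at `0`. Applying this to a curve in `C([0, T] × Ω,
  -- Jet)` makes the convergence uniform in `z`.
  have hlim := tendsto_setIntegral_pow_smul_of_unique_maximum_of_isCompact_of_continuousOn
    (μ := volume) hsc hcc.continuousOn (fun y _ => hmax y) hnn hpos (x₀ := 0) (g := g)
    (subset_closure (mem_interior_iff_mem_nhds.2 (Metric.closedBall_mem_nhds 0 (by positivity))))
    hgc.continuousOn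
  obtain ⟨n, hn⟩ := ((Metric.tendsto_nhds.1 hlim) ε hε).exists
  set m := (∫ y in s, c y ^ n)⁻¹ with hm
  have hav := hj.average hsc (hcc.pow n) m
  refine ⟨m • fun z => ∫ y, (c ^ n) (z - y) * (j y).1, Submodule.smul_mem _ _
    (convolution_mem_expSpan hj.continuous.fst hjc (pow_mem_expSpan hc n)), fun z hz => ?_⟩
  rw [hav.jet_eq hT (Metric.isOpen_ball (x := 0) (ε := R)) (z := z) ?_ (hsub (Or.inl hz)) hz.1]
  · have h1 := (ContinuousMap.dist_apply_le_dist (⟨z, hz⟩ : (Icc 0 T ×ˢ Ω : Set _))).trans hn.le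
    rw [dist_eq_norm, ContinuousMap.smul_apply, ContinuousMap.integral_apply] at h1
    · simpa [hg] using h1
    · exact ((hcc.pow n).smul hgc).continuousOn.integrableOn_compact hsc
  · intro w hw
    have hint : IntegrableOn (fun y => (c ^ n) y • j (w - y)) s :=
      ((hcc.pow n).smul (hj.continuous.comp
        (continuous_const.sub continuous_id))).continuousOn.integrableOn_compact hsc
    rw [Prod.smul_fst, fst_integral hint]
    change m * _ = m * _
    congr 1
    have : (volume : Measure (ℝ × Space d)).IsAddHaarMeasure :=
      inferInstanceAs (Measure.prod volume volume).IsAddHaarMeasure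
    have : (volume : Measure (ℝ × Space d)).IsNegInvariant :=
      Measure.IsAddHaarMeasure.isNegInvariant_of_regular _
    change ∫ y, (c ^ n) (w - y) * (j y).1 = _
    rw [← integral_sub_left_eq_self _ volume w, setIntegral_eq_integral_of_forall_compl_eq_zero]
    · simp
    · intro y hy
      have : (j (w - y)).1 = 0 := by
        by_contra h
        have h2 := hsub (Or.inr (subset_tsupport _ h))
        apply hy
        simp only [hs, mem_closedBall_zero_iff, mem_ball_zero_iff] at hw h2 ⊢
        have h3 := norm_sub_le w (w - y)
        rw [sub_sub_cancel] at h3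
        linarith
      simp [this]

end Mollification

/-! ### Local jets, products and cutoffs -/

section LocalJets

variable {d : ℕ}

/-- On the open set `O`, `j` is continuous and consists of a function on `ℝ × ℝ^d`, its time
derivative and its first two space derivatives. -/
structure IsJetFieldOn (O : Set (ℝ × Space d)) (j : ℝ × Space d → Jet d) : Prop where
  continuousOn : ContinuousOn j O
  time : ∀ z ∈ O, HasDerivAt (fun s => (j (s, z.2)).1) (j z).2.1 z.1
  space : ∀ z ∈ O, HasGradientAt (fun y => (j (z.1, y)).1) (j z).2.2.1 z.2
  space_space : ∀ z ∈ O, HasFDerivAt (fun y => (j (z.1, y)).2.2.1) (j z).2.2.2 z.2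

/-- The derivatives of a function on `ℝ × ℝ^d`. -/
def smoothJet (η : ℝ × Space d → ℝ) (z : ℝ × Space d) : Jet d :=
  (η z, fderiv ℝ η z (1, 0), rieszInv d ((fderiv ℝ η z).comp (ContinuousLinearMap.inr ℝ ℝ (Space d))),
    (fderiv ℝ (fun w => rieszInv d ((fderiv ℝ η w).comp
      (ContinuousLinearMap.inr ℝ ℝ (Space d)))) z).comp (ContinuousLinearMap.inr ℝ ℝ (Space d)))

theorem isJetField_smoothJet {η : ℝ × Space d → ℝ} (hη : ContDiff ℝ 2 η) :
    IsJetField (smoothJet η) := by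
  have h1 : ContDiff ℝ 1 (fderiv ℝ η) := hη.fderiv_right (by norm_num)
  have h2 : ContDiff ℝ 1 fun w => rieszInv d ((fderiv ℝ η w).comp
      (ContinuousLinearMap.inr ℝ ℝ (Space d))) :=
    (rieszInv d).contDiff.comp (h1.clm_comp contDiff_const)
  have hd := hη.differentiable (by norm_num)
  refine ⟨?_, fun z => ?_, fun z => ?_, fun z => ?_⟩
  · exact hη.continuous.prodMk ((h1.continuous.clm_apply continuous_const).prodMk
      (h2.continuous.prodMk ((h2.continuous_fderiv (by norm_num)).clm_comp continuous_const)))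
  · exact (hd z).hasFDerivAt.comp_hasDerivAt z.1
      ((hasDerivAt_id z.1).prodMk (hasDerivAt_const z.1 z.2))
  · have h := HasFDerivAt.comp (f := fun y : Space d => (z.1, y)) z.2
      (hd (z.1, z.2)).hasFDerivAt (hasFDerivAt_prodMk_right (𝕜 := ℝ) z.1 z.2)
    exact hasGradientAt_rieszInv h
  · exact HasFDerivAt.comp (f := fun y : Space d => (z.1, y)) z.2
      (h2.differentiable (by norm_num) (z.1, z.2)).hasFDerivAt
      (hasFDerivAt_prodMk_right (𝕜 := ℝ) z.1 z.2)

theorem smoothJet_congr {η ζ : ℝ × Space d → ℝ} {z : ℝ × Space d} (h : η =ᶠ[nhds z] ζ) :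
    smoothJet η z = smoothJet ζ z := by
  have h1 : fderiv ℝ η =ᶠ[nhds z] fderiv ℝ ζ := h.fderiv
  have h2 : (fun w => rieszInv d ((fderiv ℝ η w).comp (ContinuousLinearMap.inr ℝ ℝ (Space d))))
      =ᶠ[nhds z] fun w => rieszInv d ((fderiv ℝ ζ w).comp
        (ContinuousLinearMap.inr ℝ ℝ (Space d))) := by
    filter_upwards [h1] with w hw
    rw [hw]
  simp only [smoothJet, h.eq_of_nhds, h1.eq_of_nhds, h2.fderiv_eq]

theorem smoothJet_const (a : ℝ) (z : ℝ × Space d) : smoothJet (fun _ => a) z = (a, 0, 0, 0) := by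
  have h : fderiv ℝ (fun _ : ℝ × Space d => a) = fun _ => 0 := funext fun w => fderiv_const_apply a
  simp [smoothJet, h]

/-- The derivatives of a product of two functions. -/
def jetMul (a b : Jet d) : Jet d :=
  (a.1 * b.1, a.2.1 * b.1 + a.1 * b.2.1, a.1 • b.2.2.1 + b.1 • a.2.2.1,
    (a.1 • b.2.2.2 + (innerSL ℝ a.2.2.1).smulRight b.2.2.1) +
      (b.1 • a.2.2.2 + (innerSL ℝ b.2.2.1).smulRight a.2.2.1))

theorem jetMul_one (b : Jet d) : jetMul (1, 0, 0, 0) b = b := by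
  obtain ⟨b1, b2, b3, b4⟩ := b
  simp only [jetMul, one_mul, zero_mul, zero_add, one_smul, smul_zero, add_zero, map_zero]
  congr 3
  ext x i
  simp

theorem jetMul_zero (b : Jet d) : jetMul (0, 0, 0, 0) b = (0, 0, 0, 0) := by
  simp only [jetMul, zero_mul, zero_smul, smul_zero, add_zero, map_zero]
  congr 3
  ext x i
  simp

theorem continuous_jetMul : Continuous fun q : Jet d × Jet d => jetMul q.1 q.2 := by
  unfold jetMul
  fun_prop

/-- Every point lies either in `O`, where the product rule applies, or off the support of `η`, where
the product vanishes in a neighbourhood. -/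
theorem isJetField_mul {η : ℝ × Space d → ℝ} (hη : ContDiff ℝ 2 η) {O : Set (ℝ × Space d)}
    (hO : IsOpen O) (hηO : tsupport η ⊆ O) {w : ℝ × Space d → Jet d} (hw : IsJetFieldOn O w) :
    IsJetField fun z => jetMul (smoothJet η z) (w z) := by
  have hj := isJetField_smoothJet hη
  have hzero : ∀ z, z ∉ tsupport η → ∀ᶠ y in nhds z, jetMul (smoothJet η y) (w y) = (0, 0, 0, 0) := by
    intro z hz
    filter_upwards [(isClosed_tsupport η).isOpen_compl.mem_nhds hz] with y hy
    rw [smoothJet_congr (notMem_tsupport_iff_eventuallyEq.1 hy)]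
    exact (congrArg (jetMul · (w y)) (smoothJet_const 0 y)).trans (jetMul_zero _)
  have ht : ∀ z : ℝ × Space d, Filter.Tendsto (fun s => (s, z.2)) (nhds z.1) (nhds z) := fun z =>
    (Continuous.prodMk_left z.2).continuousAt
  have hx : ∀ z : ℝ × Space d, Filter.Tendsto (fun y => (z.1, y)) (nhds z.2) (nhds z) := fun z =>
    (Continuous.prodMk_right z.1).continuousAt
  have hcases : ∀ z, z ∈ O ∨ z ∉ tsupport η := fun z =>
    (em (z ∈ tsupport η)).imp (fun h => hηO h) id
  refine ⟨?_, fun z => ?_, fun z => ?_, fun z => ?_⟩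
  · refine continuous_iff_continuousAt.2 fun z => ?_
    rcases hcases z with hz | hz
    · exact continuous_jetMul.continuousAt.comp
        (hj.continuous.continuousAt.prodMk (hw.continuousOn.continuousAt (hO.mem_nhds hz)))
    · exact continuousAt_const.congr ((hzero z hz).mono fun y hy => hy.symm)
  · rcases hcases z with hz | hz
    · exact (hj.time z).mul (hw.time z hz)
    · rw [(hzero z hz).self_of_nhds]
      refine (hasDerivAt_const z.1 (0 : ℝ)).congr_of_eventuallyEq ?_
      filter_upwards [(ht z).eventually (hzero z hz)] with s hs
      rw [hs]
  · rcases hcases z with hz | hz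
    · have := HasFDerivAt.mul (hj.space z) (hw.space z hz)
      refine HasFDerivAt.congr_fderiv this ?_
      simp [jetMul]
    · rw [(hzero z hz).self_of_nhds]
      refine HasFDerivAt.congr_of_eventuallyEq (f := fun _ => (0 : ℝ))
        ((hasFDerivAt_const (0 : ℝ) z.2).congr_fderiv (by simp)) ?_
      filter_upwards [(hx z).eventually (hzero z hz)] with s hs
      rw [hs]
  · rcases hcases z with hz | hz
    · have h1 := HasFDerivAt.smul (hj.space z) (hw.space_space z hz)
      have h2 := HasFDerivAt.smul (hw.space z hz) (hj.space_space z)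
      exact h1.add h2
    · rw [(hzero z hz).self_of_nhds]
      refine (hasFDerivAt_const (0 : Space d) z.2).congr_of_eventuallyEq ?_
      filter_upwards [(hx z).eventually (hzero z hz)] with s hs
      rw [hs]

/-- Two compact sets are interposed: the inner one makes `η` equal to `1` near `K`, so that its
derivatives vanish there, and the outer one contains the support. -/
theorem exists_cutoff {K O : Set (ℝ × Space d)} (hK : IsCompact K) (hO : IsOpen O) (hKO : K ⊆ O) :
    ∃ η : ℝ × Space d → ℝ, ContDiff ℝ 2 η ∧ HasCompactSupport η ∧ tsupport η ⊆ O ∧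
      ∀ z ∈ K, η =ᶠ[nhds z] fun _ => 1 := by
  obtain ⟨K₁, hK₁, hKK₁, hK₁O⟩ := exists_compact_between hK hO hKO
  obtain ⟨K₂, hK₂, hK₁₂, hK₂O⟩ := exists_compact_between hK₁ hO hK₁O
  obtain ⟨f, hf0, hf1, -⟩ := exists_contMDiffMap_zero_one_of_isClosed
    (modelWithCornersSelf ℝ (ℝ × Space d)) (n := 2)
    (isOpen_interior (s := K₂)).isClosed_compl hK₁.isClosed
    (disjoint_compl_left_iff_subset.2 hK₁₂)
  have hsupp : tsupport f ⊆ K₂ := by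
    refine closure_minimal (fun z hz => ?_) hK₂.isClosed
    by_contra h
    exact hz (hf0 fun h' => h (interior_subset h'))
  refine ⟨f, f.contMDiff.contDiff, hK₂.of_isClosed_subset (isClosed_tsupport _) hsupp,
    hsupp.trans hK₂O, fun z hz => ?_⟩
  filter_upwards [mem_interior_iff_mem_nhds.1 (hKK₁ hz)] with y hy
  exact hf1 hy

end LocalJets

/-! ### Universal approximation of `C^{1,2}` functions -/

section Regularity

variable {d : ℕ} {T : ℝ} {U : Set (Space d)} {u : ℝ → Space d → ℝ}

theorem IsC12.hasFDerivAt_gradient (hu : IsC12 T U u) (hU : IsOpen U) {t : ℝ} (ht : t ∈ Icc 0 T)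
    {x : Space d} (hx : x ∈ U) : HasFDerivAt (gradient (u t))
      ((rieszInv d).comp (fderiv ℝ (fderiv ℝ (u t)) x)) x := by
  have h1 : ContDiffAt ℝ 2 (u t) x := (hu.contDiff_space t ht).contDiffAt (hU.mem_nhds hx)
  have h2 : ContDiffAt ℝ 1 (fderiv ℝ (u t)) x := h1.fderiv_right (by norm_num)
  exact (rieszInv d).hasFDerivAt.comp x (h2.differentiableAt (by norm_num)).hasFDerivAt

theorem IsC12.hasGradientAt (hu : IsC12 T U u) (hU : IsOpen U) {t : ℝ} (ht : t ∈ Icc 0 T)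
    {x : Space d} (hx : x ∈ U) : HasGradientAt (u t) (gradient (u t) x) x :=
  (((hu.contDiff_space t ht).contDiffAt (hU.mem_nhds hx)).differentiableAt
    (by norm_num)).hasGradientAt

theorem IsC12.continuousOn_jet (hu : IsC12 T U u) (hU : IsOpen U) :
    ContinuousOn (jet T u) (Icc 0 T ×ˢ U) := by
  have h3 : ContinuousOn (fun z : ℝ × Space d => gradient (u z.1) z.2) (Icc 0 T ×ˢ U) :=
    (rieszInv d).continuous.comp_continuousOn hu.continuousOn_fderiv
  have h4 : ContinuousOn (fun z : ℝ × Space d => fderiv ℝ (gradient (u z.1)) z.2)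
      (Icc 0 T ×ˢ U) := by
    refine (continuousOn_const.clm_comp hu.continuousOn_fderiv_fderiv).congr
      (f := fun z => (rieszInv d).comp (fderiv ℝ (fderiv ℝ (u z.1)) z.2)) fun z hz => ?_
    exact (hu.hasFDerivAt_gradient hU hz.1 hz.2).fderiv
  exact hu.continuousOn.prodMk (hu.continuousOn_time.prodMk (h3.prodMk h4))

/-- Contraction of time towards the midpoint of `[0, T]`. -/
def timeContraction (T q : ℝ) (z : ℝ × Space d) : ℝ × Space d := (T / 2 + q * (z.1 - T / 2), z.2)

theorem continuous_timeContraction (T q : ℝ) :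
    Continuous (timeContraction T q : ℝ × Space d → ℝ × Space d) := by
  unfold timeContraction
  fun_prop

/-- The derivatives of `u` composed with a contraction of time. -/
def contractedJet (T q : ℝ) (u : ℝ → Space d → ℝ) (z : ℝ × Space d) : Jet d :=
  ((jet T u (timeContraction T q z)).1, q * (jet T u (timeContraction T q z)).2.1,
    (jet T u (timeContraction T q z)).2.2)

/-- Where the contracted time is interior to `[0, T]`, the one-sided time derivative is a two-sided
one; the chain rule gives the factor `q`. -/
theorem IsC12.isJetFieldOn_contractedJet (hu : IsC12 T U u) (hU : IsOpen U) (q : ℝ) :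
    IsJetFieldOn (timeContraction T q ⁻¹' (Ioo 0 T ×ˢ U)) (contractedJet T q u) := by
  have hsub : Ioo 0 T ×ˢ U ⊆ Icc 0 T ×ˢ U := prod_mono Ioo_subset_Icc_self subset_rfl
  refine ⟨?_, fun z hz => ?_, fun z hz => ?_, fun z hz => ?_⟩
  · have hc : ContinuousOn (fun z => jet T u (timeContraction T q z))
        (timeContraction T q ⁻¹' (Ioo 0 T ×ˢ U)) :=
      (hu.continuousOn_jet hU).comp (continuous_timeContraction T q).continuousOn
        fun z hz => hsub hz
    exact hc.fst.prodMk ((continuousOn_const.mul hc.snd.fst).prodMk hc.snd.snd)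
  · have h1 : HasDerivAt (fun s => u s z.2)
        (derivWithin (fun s => u s z.2) (Icc 0 T) (T / 2 + q * (z.1 - T / 2)))
        (T / 2 + q * (z.1 - T / 2)) :=
      (hu.differentiable_time z.2 hz.2 _ (Ioo_subset_Icc_self hz.1)).hasDerivWithinAt.hasDerivAt
        (Icc_mem_nhds hz.1.1 hz.1.2)
    have h2 : HasDerivAt (fun s : ℝ => T / 2 + q * (s - T / 2)) q z.1 := by
      simpa using (((hasDerivAt_id z.1).sub_const (T / 2)).const_mul q).const_add (T / 2)
    exact (h1.comp z.1 h2).congr_deriv (mul_comm _ _)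
  · exact hu.hasGradientAt hU (Ioo_subset_Icc_self hz.1) hz.2
  · exact (hu.hasFDerivAt_gradient hU (Ioo_subset_Icc_self hz.1) hz.2).differentiableAt.hasFDerivAt

/-- With `q = 1 - r`, points move by at most `r T`, which uniform continuity of the jet absorbs, and
the factor `q` changes the time derivative by at most `r |B|`. For `0 < r < 1` the closed interval
lands in the open one. -/
theorem IsC12.exists_contractedJet_close (hu : IsC12 T U u) (hU : IsOpen U) (hT : 0 < T)
    {Ω : Set (Space d)} (hΩ : IsCompact Ω) (hΩU : Ω ⊆ U) {ε : ℝ} (hε : 0 < ε) :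
    ∃ q, (∀ z ∈ Icc 0 T ×ˢ Ω, timeContraction T q z ∈ Ioo 0 T ×ˢ U) ∧
      ∀ z ∈ Icc 0 T ×ˢ Ω, ‖contractedJet T q u z - jet T u z‖ ≤ ε := by
  have hE : IsCompact (Icc 0 T ×ˢ Ω) := isCompact_Icc.prod hΩ
  have hc : ContinuousOn (jet T u) (Icc 0 T ×ˢ Ω) :=
    (hu.continuousOn_jet hU).mono (prod_mono subset_rfl hΩU)
  obtain ⟨B, hB⟩ := hE.exists_bound_of_continuousOn hc
  obtain ⟨δ, hδ, hunif⟩ := Metric.uniformContinuousOn_iff.1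
    (hE.uniformContinuousOn_of_continuous hc) (ε / 2) (half_pos hε)
  obtain ⟨r, hr0, hr1, hrδ, hrε⟩ : ∃ r : ℝ, 0 < r ∧ r < 1 ∧ r * T < δ ∧ r * |B| ≤ ε / 2 := by
    have hf : Filter.Tendsto (fun r : ℝ => r) (nhdsWithin 0 (Ioi 0)) (nhds 0) :=
      tendsto_nhdsWithin_of_tendsto_nhds Filter.tendsto_id
    have h1 := hf.eventually (gt_mem_nhds one_pos)
    have h2 := (by simpa using hf.mul_const T : Filter.Tendsto (fun r : ℝ => r * T)
      (nhdsWithin 0 (Ioi 0)) (nhds 0)).eventually (gt_mem_nhds hδ)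
    have h3 := (by simpa using hf.mul_const |B| : Filter.Tendsto (fun r : ℝ => r * |B|)
      (nhdsWithin 0 (Ioi 0)) (nhds 0)).eventually (gt_mem_nhds (half_pos hε))
    have h0 : ∀ᶠ r in nhdsWithin (0 : ℝ) (Ioi 0), 0 < r := self_mem_nhdsWithin
    obtain ⟨r, hr⟩ := (h0.and (h1.and (h2.and h3))).exists
    exact ⟨r, hr.1, hr.2.1, hr.2.2.1, hr.2.2.2.le⟩
  have hmaps : ∀ z ∈ Icc 0 T ×ˢ Ω, (timeContraction T (1 - r) z).1 ∈ Ioo 0 T := by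
    intro z hz
    have h0 := hz.1.1
    have h1 := hz.1.2
    constructor <;> simp only [timeContraction] <;> nlinarith
  refine ⟨1 - r, fun z hz => ⟨hmaps z hz, hΩU hz.2⟩, fun z hz => ?_⟩
  set w := timeContraction T (1 - r) z with hw
  have hwE : w ∈ Icc 0 T ×ˢ Ω := ⟨Ioo_subset_Icc_self (hmaps z hz), hz.2⟩
  have hdist : dist w z < δ := by
    refine lt_of_le_of_lt ?_ hrδ
    rw [Prod.dist_eq]
    refine max_le ?_ (by simp only [hw, timeContraction, dist_self]; positivity)
    have h0 := hz.1.1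
    have h1 := hz.1.2
    rw [Real.dist_eq, abs_le]
    constructor <;> simp only [hw, timeContraction] <;> nlinarith
  have h1 := (hunif w hwE z hz hdist).le
  rw [dist_eq_norm] at h1
  have h2 : ‖contractedJet T (1 - r) u z - jet T u w‖ ≤ ε / 2 := by
    have e : contractedJet T (1 - r) u z - jet T u w = (0, -r * (jet T u w).2.1, 0) := by
      refine Prod.ext (sub_self _) (Prod.ext ?_ (sub_self _))
      change (1 - r) * (jet T u w).2.1 - (jet T u w).2.1 = _
      ring
    have hb : |(jet T u w).2.1| ≤ |B| :=
      ((norm_fst_le _).trans (norm_snd_le _)).trans ((hB w hwE).trans (le_abs_self B))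
    rw [e, norm_prod_le_iff, norm_prod_le_iff]
    refine ⟨by simpa using (half_pos hε).le, ?_, by simpa using (half_pos hε).le⟩
    rw [Real.norm_eq_abs, abs_mul, abs_neg, abs_of_pos hr0]
    exact (mul_le_mul_of_nonneg_left hb hr0.le).trans hrε
  calc ‖contractedJet T (1 - r) u z - jet T u z‖
      = ‖(contractedJet T (1 - r) u z - jet T u w) + (jet T u w - jet T u z)‖ := by
        rw [sub_add_sub_cancel]
    _ ≤ ε / 2 + ε / 2 := (norm_add_le _ _).trans (add_le_add h2 h1)
    _ = ε := by ring

variable {σ : ℝ → ℝ}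

theorem isNetworkLimit_of_mem_expSpan (hσ : ContDiff ℝ 2 σ) (hσb : ∃ M : ℝ, ∀ s, |σ s| ≤ M)
    (hσc : ∃ a b, σ a ≠ σ b) (hT : 0 < T) {Ω : Set (Space d)} (hΩ : IsCompact Ω)
    {Q : ℝ × Space d → ℝ} (hQ : Q ∈ expSpan (ℝ × Space d)) :
    IsNetworkLimit σ T Ω (Function.curry Q) := by
  induction hQ using Submodule.span_induction with
  | mem f hf =>
    obtain ⟨L, rfl⟩ := hf
    exact isNetworkLimit_ridgeFunction hσ hσb hσc hT hΩ Real.contDiff_exp L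
  | zero => exact isNetworkLimit_zero
  | add f g _ _ hf hg => exact hf.add hσ hg
  | smul a f _ hf => exact hf.smul hσ a

/-- Universal approximation in `C^{1,2}`. -/
theorem IsC12.exists_network_close (hu : IsC12 T U u) (hσ : ContDiff ℝ 2 σ)
    (hσb : ∃ M : ℝ, ∀ s, |σ s| ≤ M) (hσc : ∃ a b, σ a ≠ σ b) (hT : 0 < T) (hU : IsOpen U)
    {Ω : Set (Space d)} (hΩ : IsCompact Ω) (hΩU : Ω ⊆ U) {ε : ℝ} (hε : 0 < ε) :
    ∃ N ∈ Networks d σ, ∀ z ∈ Icc 0 T ×ˢ Ω, ‖jet T N z - jet T u z‖ ≤ ε := by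
  -- The error splits in three: time contraction, exponential sums, networks.
  obtain ⟨q, hq, hclose⟩ := hu.exists_contractedJet_close hU hT hΩ hΩU (ε := ε / 3) (by positivity)
  have hO : IsOpen (timeContraction T q ⁻¹' (Ioo 0 T ×ˢ U)) :=
    (isOpen_Ioo.prod hU).preimage (continuous_timeContraction T q)
  obtain ⟨η, hη, hηc, hηO, hη1⟩ := exists_cutoff (isCompact_Icc.prod hΩ) hO hq
  have hj := isJetField_mul hη hO hηO (hu.isJetFieldOn_contractedJet hU q)
  have hjc : HasCompactSupport fun z => (jetMul (smoothJet η z) (contractedJet T q u z)).1 :=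
    HasCompactSupport.mul_right (f := η) hηc
  obtain ⟨Q, hQ, hQclose⟩ := hj.exists_expSpan_close hjc hT hΩ (ε := ε / 3) (by positivity)
  obtain ⟨N, hN, hNclose⟩ :=
    (isNetworkLimit_of_mem_expSpan hσ hσb hσc hT hΩ hQ).2 (ε / 3) (by positivity)
  refine ⟨N, hN, fun z hz => ?_⟩
  have h1 := hQclose z hz
  have h0 : smoothJet η z = (1, 0, 0, 0) := (smoothJet_congr (hη1 z hz)).trans (smoothJet_const 1 z)
  rw [h0, jetMul_one] at h1
  calc ‖jet T N z - jet T u z‖ = ‖(jet T N z - jet T (Function.curry Q) z) +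
        (jet T (Function.curry Q) z - contractedJet T q u z) +
        (contractedJet T q u z - jet T u z)‖ := by
        rw [sub_add_sub_cancel, sub_add_sub_cancel]
    _ ≤ ε / 3 + ε / 3 + ε / 3 := (norm_add_le _ _).trans (add_le_add ((norm_add_le _ _).trans
        (add_le_add (hNclose z hz) h1)) (hclose z hz))
    _ = ε := by ring

end Regularity

/-! ### The residuals as functions of jets -/

section Symbols

variable {d : ℕ}

/-- The trace of an endomorphism of `ℝ^d`. -/
def coordTrace (A : Space d →L[ℝ] Space d) : ℝ := ∑ i, A (EuclideanSpace.single i 1) i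

theorem continuous_coordTrace : Continuous (coordTrace : (Space d →L[ℝ] Space d) → ℝ) := by
  unfold coordTrace
  fun_prop

theorem rieszInv_apply (l : Space d →L[ℝ] ℝ) (i : Fin d) :
    rieszInv d l i = l (EuclideanSpace.single i 1) := by
  have h : inner ℝ (rieszInv d l) (EuclideanSpace.single i 1) = l (EuclideanSpace.single i 1) :=
    InnerProductSpace.toDual_symm_apply
  rw [← h, EuclideanSpace.inner_single_right]
  simp

theorem laplacian_eq_coordTrace {f : Space d → ℝ} {x : Space d} (hf : ContDiffAt ℝ 2 f x) :
    Laplacian.laplacian f x = coordTrace (fderiv ℝ (gradient f) x) := by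
  have h1 : DifferentiableAt ℝ (fderiv ℝ f) x :=
    (hf.fderiv_right (m := 1) (by norm_num)).differentiableAt (by norm_num)
  have h2 : fderiv ℝ (gradient f) x = (rieszInv d).comp (fderiv ℝ (fderiv ℝ f) x) :=
    ((rieszInv d).hasFDerivAt.comp x h1.hasFDerivAt).fderiv
  rw [InnerProductSpace.laplacian_eq_iteratedFDeriv_orthonormalBasis f
    (EuclideanSpace.basisFun (Fin d) ℝ), coordTrace, h2]
  refine Finset.sum_congr rfl fun i _ => ?_
  rw [iteratedFDeriv_two_apply, ContinuousLinearMap.comp_apply, rieszInv_apply]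
  simp

/-- The part of the Hamilton–Jacobi–Bellman operator that does not involve the Hamiltonian. -/
def heatSymbol (ν : ℝ) (b : Jet d) : ℝ := b.2.1 + ν * coordTrace b.2.2.2

theorem continuous_heatSymbol (ν : ℝ) : Continuous (heatSymbol ν : Jet d → ℝ) :=
  continuous_snd.fst.add (continuous_const.mul (continuous_coordTrace.comp continuous_snd.snd.snd))

variable {T ν : ℝ} {H : Space d → ℝ → Space d → ℝ} {ρ φ : ℝ → Space d → ℝ}

theorem hjbResidual_eq {z : ℝ × Space d} (hφ : ContDiffAt ℝ 2 (φ z.1) z.2) :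
    hjbResidual T ν H ρ φ z.1 z.2 = heatSymbol ν (jet T φ z) -
      H z.2 (jet T ρ z).1 (jet T φ z).2.2.1 := by
  rw [hjbResidual, laplacian_eq_coordTrace hφ]
  rfl

/-- The derivative in `x` of `ρ ∇_p H(x, ρ, ∇φ)` as a function of the derivatives of `ρ` and
`φ`. -/
def fluxDerivative (H : Space d → ℝ → Space d → ℝ) (x : Space d) (a b : Jet d) :
    Space d →L[ℝ] Space d :=
  a.1 • (fderiv ℝ (fun z : Space d × ℝ × Space d => gradP H z.1 z.2.1 z.2.2)
      (x, a.1, b.2.2.1)).comp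
      ((ContinuousLinearMap.id ℝ (Space d)).prod ((innerSL ℝ a.2.2.1).prod b.2.2.2)) +
    (innerSL ℝ a.2.2.1).smulRight (gradP H x a.1 b.2.2.1)

/-- The Fokker–Planck operator as a function of the derivatives of `ρ` and `φ`. -/
def fpSymbol (ν : ℝ) (H : Space d → ℝ → Space d → ℝ) (q : Space d × Jet d × Jet d) : ℝ :=
  heatSymbol (-ν) q.2.1 - coordTrace (fluxDerivative H q.1 q.2.1 q.2.2)

/-- The product and chain rules give the derivative of the flux, whose trace is the divergence; `y ↦
(y, ρ, ∇φ)` is differentiable and `∇_p H` is `C¹` near its value. -/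
theorem fpResidual_eq {U : Set (Space d)} (hU : IsOpen U)
    (hH : ContDiffOn ℝ 1 (fun z : Space d × ℝ × Space d => gradP H z.1 z.2.1 z.2.2) (U ×ˢ univ))
    {z : ℝ × Space d} (hz : z.2 ∈ U) (hρ : ContDiffAt ℝ 2 (ρ z.1) z.2)
    (hφ : ContDiffAt ℝ 2 (φ z.1) z.2) :
    fpResidual T ν H ρ φ z.1 z.2 = fpSymbol ν H (z.2, jet T ρ z, jet T φ z) := by
  have h1 : HasFDerivAt (ρ z.1) (innerSL ℝ (gradient (ρ z.1) z.2)) z.2 :=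
    (hρ.differentiableAt (by norm_num)).hasGradientAt.hasFDerivAt
  have h2 : HasFDerivAt (gradient (φ z.1)) (fderiv ℝ (gradient (φ z.1)) z.2) z.2 :=
    ((rieszInv d).differentiableAt.comp z.2
      ((hφ.fderiv_right (m := 1) (by norm_num)).differentiableAt (by norm_num))).hasFDerivAt
  have h3 := ((hH.contDiffAt (x := (z.2, ρ z.1 z.2, gradient (φ z.1) z.2))
    ((hU.prod isOpen_univ).mem_nhds ⟨hz, mem_univ _⟩)).differentiableAt (by norm_num)).hasFDerivAt
  have h4 := HasFDerivAt.comp (f := fun y => (y, ρ z.1 y, gradient (φ z.1) y)) z.2 h3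
    ((hasFDerivAt_id z.2).prodMk (h1.prodMk h2))
  have h5 : fderiv ℝ (fun y => ρ z.1 y • gradP H y (ρ z.1 y) (gradient (φ z.1) y)) z.2 =
      fluxDerivative H z.2 (jet T ρ z) (jet T φ z) := (h1.smul h4).fderiv
  rw [fpResidual, divergence, h5, laplacian_eq_coordTrace hρ]
  simp only [fpSymbol, heatSymbol, jet, coordTrace]
  ring

theorem continuousOn_fpSymbol (ν : ℝ) {U : Set (Space d)} (hU : IsOpen U)
    (hH : ContDiffOn ℝ 1 (fun z : Space d × ℝ × Space d => gradP H z.1 z.2.1 z.2.2) (U ×ˢ univ)) :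
    ContinuousOn (fpSymbol ν H) (U ×ˢ univ) := by
  have h1 := hH.continuousOn
  have h2 := hH.continuousOn_fderiv_of_isOpen (hU.prod isOpen_univ) le_rfl
  have hm : ContinuousOn (fun q : Space d × Jet d × Jet d => (q.1, q.2.1.1, q.2.2.2.2.1))
      (U ×ˢ univ) := by fun_prop
  have hmaps : MapsTo (fun q : Space d × Jet d × Jet d => (q.1, q.2.1.1, q.2.2.2.2.1))
      (U ×ˢ univ) (U ×ˢ univ) := fun q hq => ⟨hq.1, mem_univ _⟩
  have h1' := h1.comp hm hmaps
  have h2' := h2.comp hm hmaps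
  -- The trace only evaluates the flux derivative at basis vectors, so continuity at each fixed
  -- vector suffices.
  have h3 : ∀ e : Space d, ContinuousOn (fun q : Space d × Jet d × Jet d =>
      fluxDerivative H q.1 q.2.1 q.2.2 e) (U ×ˢ univ) := by
    intro e
    have he : ContinuousOn (fun q : Space d × Jet d × Jet d =>
        ((e, inner ℝ q.2.1.2.2.1 e, q.2.2.2.2.2 e) : Space d × ℝ × Space d)) (U ×ˢ univ) := by
      fun_prop
    have hr : ContinuousOn (fun q : Space d × Jet d × Jet d => q.2.1.1) (U ×ˢ univ) := by fun_prop
    have hi : ContinuousOn (fun q : Space d × Jet d × Jet d => inner ℝ q.2.1.2.2.1 e)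
        (U ×ˢ univ) := by fun_prop
    exact (hr.smul (h2'.clm_apply he)).add (hi.smul h1')
  refine ((continuous_heatSymbol (-ν)).comp continuous_snd.fst).continuousOn.sub
    (continuousOn_finsetSum _ fun i _ => ?_)
  exact (EuclideanSpace.proj i : Space d →L[ℝ] ℝ).continuous.comp_continuousOn (h3 _)

end Symbols

/-! ### Stability of the residuals -/

section Stability

variable {d : ℕ}

/-- A function continuous near the compact graph of a jet is uniformly continuous there. -/
theorem exists_delta_of_continuousOn {E : Set (ℝ × Space d)} (hE : IsCompact E)
    {U : Set (Space d)} (hU : IsOpen U) (hEU : ∀ z ∈ E, z.2 ∈ U)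
    {Φ : Space d × Jet d × Jet d → ℝ} (hΦ : ContinuousOn Φ (U ×ˢ univ))
    {j k : ℝ × Space d → Jet d} (hj : ContinuousOn j E) (hk : ContinuousOn k E) {ε : ℝ}
    (hε : 0 < ε) : ∃ δ > 0, ∀ z ∈ E, ∀ a b, ‖a - j z‖ < δ → ‖b - k z‖ < δ →
      |Φ (z.2, a, b) - Φ (z.2, j z, k z)| < ε := by
  have hcont : ContinuousOn (fun z => (z.2, j z, k z)) E :=
    continuous_snd.continuousOn.prodMk (hj.prodMk hk)
  have hK := hE.image_of_continuousOn hcont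
  have hat : ∀ q ∈ (fun z => (z.2, j z, k z)) '' E, ContinuousAt Φ q := by
    rintro _ ⟨z, hz, rfl⟩
    exact hΦ.continuousAt ((hU.prod isOpen_univ).mem_nhds ⟨hEU z hz, mem_univ _⟩)
  -- Only one of the two compared points needs to lie in the compact graph.
  have hun := hK.uniformContinuousAt_of_continuousAt Φ hat (Metric.dist_mem_uniformity hε)
  obtain ⟨δ, hδ, h⟩ := Metric.mem_uniformity_dist.1 hun
  refine ⟨δ, hδ, fun z hz a b ha hb => ?_⟩
  have hd : dist (z.2, j z, k z) (z.2, a, b) < δ := by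
    rw [Prod.dist_eq, Prod.dist_eq, dist_self, dist_comm (j z), dist_comm (k z), dist_eq_norm,
      dist_eq_norm]
    exact max_lt hδ (max_lt ha hb)
  have := h hd ⟨z, hz, rfl⟩
  rwa [mem_ofPred_eq, dist_comm, Real.dist_eq] at this

variable {Ω : Set (Space d)}

theorem PolyLipschitz.continuous {F : Type*} [NormedAddCommGroup F]
    {f : Space d → ℝ → Space d → F} (hf : PolyLipschitz Ω f) {x : Space d} (hx : x ∈ Ω) :
    Continuous fun i : ℝ × Space d => f x i.1 i.2 := by
  obtain ⟨K, q, h⟩ := hf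
  refine continuous_iff_continuousAt.2 fun i => ?_
  rw [ContinuousAt, tendsto_iff_norm_sub_tendsto_zero]
  refine squeeze_zero (fun _ => norm_nonneg _) (fun k => h x hx k.1 i.1 k.2 i.2) ?_
  have hc : Continuous fun k : ℝ × Space d =>
      K * (1 + |k.1| + ‖k.2‖ + |i.1| + ‖i.2‖) ^ q * (|k.1 - i.1| + ‖k.2 - i.2‖) := by fun_prop
  simpa using hc.tendsto i

/-- On bounded arguments the polynomial factor is bounded, so `f` is uniformly continuous in `(r,
p)`, uniformly in `x`, with no continuity in `x`. -/
theorem PolyLipschitz.exists_delta {f : Space d → ℝ → Space d → ℝ} (hf : PolyLipschitz Ω f)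
    (M : ℝ) {ε : ℝ} (hε : 0 < ε) : ∃ δ > 0, ∀ x ∈ Ω, ∀ r s p p', |s| ≤ M → ‖p'‖ ≤ M →
      |r - s| < δ → ‖p - p'‖ < δ → |f x r p - f x s p'| < ε := by
  obtain ⟨K, q, h⟩ := hf
  -- As `δ ≤ 1`, `|r|` and `‖p‖` are at most `1 + |M|`, which gives `1 + 2 (1 + |M|) + 2 |M|`.
  set C := |K| * (3 + 4 * |M|) ^ q with hC
  have hC0 : 0 ≤ C := by positivity
  refine ⟨min 1 (ε / (2 * (C + 1))), by positivity, fun x hx r s p p' hs hp' hr hp => ?_⟩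
  have hr1 := hr.trans_le (min_le_left _ _)
  have hp1 := hp.trans_le (min_le_left _ _)
  have hr2 := hr.trans_le (min_le_right _ _)
  have hp2 := hp.trans_le (min_le_right _ _)
  have hM := le_abs_self M
  have e1 : |r| ≤ 1 + |M| := by
    have := abs_add_le (r - s) s
    rw [sub_add_cancel] at this
    linarith
  have e2 : ‖p‖ ≤ 1 + |M| := by
    have := norm_add_le (p - p') p'
    rw [sub_add_cancel] at this
    linarith
  have h1 : K * (1 + |r| + ‖p‖ + |s| + ‖p'‖) ^ q ≤ C := by
    have hb : 1 + |r| + ‖p‖ + |s| + ‖p'‖ ≤ 3 + 4 * |M| := by linarith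
    calc K * (1 + |r| + ‖p‖ + |s| + ‖p'‖) ^ q ≤ |K| * (1 + |r| + ‖p‖ + |s| + ‖p'‖) ^ q := by
          gcongr
          exact le_abs_self K
      _ ≤ C := by rw [hC]; gcongr
  calc |f x r p - f x s p'| ≤ _ := h x hx r s p p'
    _ ≤ C * (|r - s| + ‖p - p'‖) := by gcongr
    _ ≤ C * (ε / (2 * (C + 1)) + ε / (2 * (C + 1))) := by gcongr
    _ = ε * (C / (C + 1)) := by field_simp; ring
    _ < ε * 1 := by
        gcongr
        rw [div_lt_one (by positivity)]
        linarith
    _ = ε := mul_one ε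

end Stability

/-! ### From uniform bounds to `L²` bounds -/

section Integrals

variable {α : Type*} [MeasurableSpace α] {μ : Measure α} [IsFiniteMeasure μ] {f : α → ℝ} {C : ℝ}

theorem integral_sq_le_of_ae_abs_le (hC : ∀ᵐ x ∂μ, |f x| ≤ C) :
    ∫ x, |f x| ^ 2 ∂μ ≤ C ^ 2 * μ.real univ := by
  rw [← Real.norm_of_nonneg (integral_nonneg fun x => sq_nonneg |f x|)]
  refine norm_integral_le_of_norm_le_const ?_
  filter_upwards [hC] with x hx
  rw [Real.norm_eq_abs, abs_pow, abs_abs]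
  gcongr

end Integrals

/-! ### Continuity and measurability along networks -/

section Networks

variable {d : ℕ} {σ : ℝ → ℝ} {T : ℝ} {Ω : Set (Space d)}

theorem continuousOn_jet_network (hσ : ContDiff ℝ 2 σ) (hT : 0 < T) {N : ℝ → Space d → ℝ}
    (hN : N ∈ Networks d σ) : ContinuousOn (jet T N) (Icc 0 T ×ˢ Ω) := by
  have hj := isJetField_smoothJet (networks_contDiff hσ hN)
  refine hj.continuous.continuousOn.congr fun z hz => ?_
  exact hj.jet_eq hT isOpen_univ (fun w _ => rfl) (mem_univ z) hz.1

/-- `H` is a Carathéodory function on `Ω`: measurable in `x` and continuous in `(r, p)`, hence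
jointly measurable. -/
theorem aestronglyMeasurable_hamiltonian {H : Space d → ℝ → Space d → ℝ}
    (hΩ : IsCompact Ω) (hm : ∀ (r : ℝ) (p : Space d), Measurable fun x : Ω => H x r p)
    (hH : PolyLipschitz Ω H) {μ : Measure (ℝ × Space d)} {r : ℝ × Space d → ℝ}
    {p : ℝ × Space d → Space d} (hr : ContinuousOn r (Icc 0 T ×ˢ Ω))
    (hp : ContinuousOn p (Icc 0 T ×ˢ Ω)) :
    AEStronglyMeasurable (fun z => H z.2 (r z) (p z)) (μ.restrict (Icc 0 T ×ˢ Ω)) := by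
  have hE : MeasurableSet (Icc 0 T ×ˢ Ω) := (isCompact_Icc.prod hΩ).measurableSet
  have hu : Measurable (Function.uncurry fun (i : ℝ × Space d) (x : Ω) => H x i.1 i.2) :=
    measurable_uncurry_of_continuous_of_measurable (fun x => hH.continuous x.2)
      fun i => hm i.1 i.2
  refine AEMeasurable.aestronglyMeasurable (aemeasurable_restrict_of_measurable_subtype hE ?_)
  have hr' := (continuousOn_iff_continuous_domRestrict.1 hr).measurable
  have hp' := (continuousOn_iff_continuous_domRestrict.1 hp).measurable
  have hx : Measurable fun z : (Icc 0 T ×ˢ Ω : Set (ℝ × Space d)) => (⟨z.1.2, z.2.2⟩ : Ω) :=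
    (measurable_snd.comp measurable_subtype_coe).subtype_mk
  exact hu.comp ((hr'.prodMk hp').prodMk hx)

end Networks

/-! ### Small residuals and the theorem -/

theorem IsMFGSolution.exists_network_residuals_le {d : ℕ} {σ : ℝ → ℝ} (hσ : ContDiff ℝ 2 σ)
    (hσb : ∃ M : ℝ, ∀ s, |σ s| ≤ M) (hσc : ∃ a b, σ a ≠ σ b) {T ν : ℝ} (hT : 0 < T)
    {Ω U : Set (Space d)} (hΩ : IsCompact Ω) (hU : IsOpen U) (hΩU : Ω ⊆ U)
    {H : Space d → ℝ → Space d → ℝ} (hH : HamiltonianAssumptions Ω U H) {ρ₀ : Space d → ℝ}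
    {g : Space d → ℝ → ℝ} {φ ρ : ℝ → Space d → ℝ} (hsol : IsMFGSolution T ν Ω U H ρ₀ g φ ρ)
    {ε : ℝ} (hε : 0 < ε) :
    ∃ ρθ ∈ Networks d σ, ∃ φω ∈ Networks d σ,
      (∀ z ∈ Icc 0 T ×ˢ Ω, |hjbResidual T ν H ρθ φω z.1 z.2| ≤ ε) ∧
      (∀ z ∈ Icc 0 T ×ˢ Ω, |fpResidual T ν H ρθ φω z.1 z.2| ≤ ε) ∧
      (∀ x ∈ Ω, |φω T x - φ T x| ≤ ε) ∧ ∀ x ∈ Ω, |ρθ 0 x - ρ₀ x| ≤ ε := by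
  have hE : IsCompact (Icc 0 T ×ˢ Ω) := isCompact_Icc.prod hΩ
  have hEU : ∀ z ∈ Icc 0 T ×ˢ Ω, z.2 ∈ U := fun z hz => hΩU hz.2
  have hjρ : ContinuousOn (jet T ρ) (Icc 0 T ×ˢ Ω) :=
    (hsol.regular_rho.continuousOn_jet hU).mono (prod_mono subset_rfl hΩU)
  have hjφ : ContinuousOn (jet T φ) (Icc 0 T ×ˢ Ω) :=
    (hsol.regular_phi.continuousOn_jet hU).mono (prod_mono subset_rfl hΩU)
  obtain ⟨δ₁, hδ₁, h₁⟩ := exists_delta_of_continuousOn hE hU hEU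
    (continuousOn_fpSymbol ν hU hH.contDiff_gradP) hjρ hjφ hε
  obtain ⟨δ₂, hδ₂, h₂⟩ := exists_delta_of_continuousOn hE hU hEU
    (Φ := fun q => heatSymbol ν q.2.2)
    ((continuous_heatSymbol ν).comp continuous_snd.snd).continuousOn hjρ hjφ (half_pos hε)
  obtain ⟨M₁, hM₁⟩ := hE.exists_bound_of_continuousOn hjρ
  obtain ⟨M₂, hM₂⟩ := hE.exists_bound_of_continuousOn hjφ
  obtain ⟨δ₃, hδ₃, h₃⟩ := hH.lipschitz.exists_delta (max M₁ M₂) (half_pos hε)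
  -- `δ₁` serves the Fokker–Planck residual, `δ₂` and `δ₃` the linear and Hamiltonian halves of the
  -- other one, and `ε` the initial and terminal data.
  set δ := min (min δ₁ δ₂) (min δ₃ ε) with hδ
  have hδ0 : 0 < δ := by positivity
  obtain ⟨ρθ, hρθ, hρc⟩ := hsol.regular_rho.exists_network_close hσ hσb hσc hT hU hΩ hΩU
    (half_pos hδ0)
  obtain ⟨φω, hφω, hφc⟩ := hsol.regular_phi.exists_network_close hσ hσb hσc hT hU hΩ hΩU
    (half_pos hδ0)
  have hρlt : ∀ z ∈ Icc 0 T ×ˢ Ω, ‖jet T ρθ z - jet T ρ z‖ < δ := fun z hz =>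
    (hρc z hz).trans_lt (half_lt_self hδ0)
  have hφlt : ∀ z ∈ Icc 0 T ×ˢ Ω, ‖jet T φω z - jet T φ z‖ < δ := fun z hz =>
    (hφc z hz).trans_lt (half_lt_self hδ0)
  have hd1 : δ ≤ δ₁ := (min_le_left _ _).trans (min_le_left _ _)
  have hd2 : δ ≤ δ₂ := (min_le_left _ _).trans (min_le_right _ _)
  have hd3 : δ ≤ δ₃ := (min_le_right _ _).trans (min_le_left _ _)
  have hd4 : δ ≤ ε := (min_le_right _ _).trans (min_le_right _ _)
  have hC12 : ∀ u, IsC12 T U u → ∀ z ∈ Icc 0 T ×ˢ Ω, ContDiffAt ℝ 2 (u z.1) z.2 :=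
    fun u hu z hz => (hu.contDiff_space z.1 hz.1).contDiffAt (hU.mem_nhds (hΩU hz.2))
  have hNet : ∀ N ∈ Networks d σ, ∀ z : ℝ × Space d, ContDiffAt ℝ 2 (N z.1) z.2 :=
    fun N hN z => (contDiff_space (networks_contDiff hσ hN) z.1).contDiffAt
  refine ⟨ρθ, hρθ, φω, hφω, fun z hz => ?_, fun z hz => ?_, fun x hx => ?_, fun x hx => ?_⟩
  · have e := hsol.hjb z.1 hz.1 z.2 hz.2
    rw [hjbResidual_eq (hC12 φ hsol.regular_phi z hz)] at e
    rw [hjbResidual_eq (hNet φω hφω z)]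
    have a1 := h₂ z hz _ _ ((hρlt z hz).trans_le hd2) ((hφlt z hz).trans_le hd2)
    have a2 := h₃ z.2 hz.2 (jet T ρθ z).1 (jet T ρ z).1 (jet T φω z).2.2.1 (jet T φ z).2.2.1
      ((norm_fst_le _).trans ((hM₁ z hz).trans (le_max_left _ _)))
      ((norm_fst_le _).trans ((norm_snd_le _).trans ((norm_snd_le _).trans
        ((hM₂ z hz).trans (le_max_right _ _)))))
      ((norm_fst_le (jet T ρθ z - jet T ρ z)).trans_lt ((hρlt z hz).trans_le hd3))
      (((norm_fst_le (jet T φω z - jet T φ z).2.2).trans ((norm_snd_le _).trans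
        (norm_snd_le _))).trans_lt ((hφlt z hz).trans_le hd3))
    rw [abs_lt] at a1 a2
    rw [abs_le]
    constructor <;> linarith [a1.1, a1.2, a2.1, a2.2]
  · have e := hsol.fp z.1 hz.1 z.2 hz.2
    rw [fpResidual_eq hU hH.contDiff_gradP (hΩU hz.2) (hC12 ρ hsol.regular_rho z hz)
      (hC12 φ hsol.regular_phi z hz)] at e
    rw [fpResidual_eq hU hH.contDiff_gradP (hΩU hz.2) (hNet ρθ hρθ z) (hNet φω hφω z)]
    have a1 := h₁ z hz _ _ ((hρlt z hz).trans_le hd1) ((hφlt z hz).trans_le hd1)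
    rw [e, sub_zero] at a1
    exact a1.le
  · exact (norm_fst_le (jet T φω (T, x) - jet T φ (T, x))).trans
      ((hφlt (T, x) ⟨⟨hT.le, le_rfl⟩, hx⟩).le.trans hd4)
  · rw [← hsol.initial x hx]
    exact (norm_fst_le (jet T ρθ (0, x) - jet T ρ (0, x))).trans
      ((hρlt (0, x) ⟨⟨le_rfl, hT.le⟩, hx⟩).le.trans hd4)

end

theorem theorem3p1 (d : ℕ) (σ : ℝ → ℝ) (hσ : ContDiff ℝ 2 σ) (hσb : ∃ M : ℝ, ∀ s, |σ s| ≤ M)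
    (hσc : ∃ a b, σ a ≠ σ b)
    (T : ℝ) (hT : 0 < T) (ν : ℝ)
    (Ω U : Set (Space d)) (hΩ : IsCompact Ω) (hU : IsOpen U) (hΩU : Ω ⊆ U)
    (μ₁ : Measure (ℝ × Space d)) [IsFiniteMeasure μ₁] (hμ₁ : μ₁ (Icc 0 T ×ˢ Ω)ᶜ = 0)
    (μ₂ : Measure (Space d)) [IsFiniteMeasure μ₂] (hμ₂ : μ₂ Ωᶜ = 0)
    (H : Space d → ℝ → Space d → ℝ) (hH : HamiltonianAssumptions Ω U H)
    (ρ₀ : Space d → ℝ) (g : Space d → ℝ → ℝ) (φ ρ : ℝ → Space d → ℝ)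
    (hsol : IsMFGSolution T ν Ω U H ρ₀ g φ ρ) :
    ∃ C₁ > 0, ∃ C₂ > 0, ∀ ε > 0, ∃ ρθ ∈ Networks d σ, ∃ φω ∈ Networks d σ,
      MemLp (fun z : ℝ × Space d => hjbResidual T ν H ρθ φω z.1 z.2) 2 μ₁ ∧
      MemLp (fun z : ℝ × Space d => fpResidual T ν H ρθ φω z.1 z.2) 2 μ₁ ∧
      MemLp (fun x => φω T x - φ T x) 2 μ₂ ∧
      MemLp (fun x => ρθ 0 x - ρ₀ x) 2 μ₂ ∧
      hjbLoss T ν H φ μ₁ μ₂ ρθ φω ≤ C₁ * ε ∧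
      fpLoss T ν H ρ₀ μ₁ μ₂ ρθ φω ≤ C₂ * ε := by
  -- A uniform error `η` costs at most `η² m`, with `m` the total mass, so `η² = ε / (m + 1)`
  -- permits both constants to be `1`; the `+ 1` covers `m = 0`.
  refine ⟨1, one_pos, 1, one_pos, fun ε hε => ?_⟩
  set m := μ₁.real univ + μ₂.real univ with hm
  have hm0 : 0 ≤ m := by positivity
  set η := Real.sqrt (ε / (m + 1)) with hη
  have hη0 : 0 < η := Real.sqrt_pos.2 (by positivity)
  have hηm : η ^ 2 * μ₁.real univ + η ^ 2 * μ₂.real univ ≤ 1 * ε := by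
    rw [hη, Real.sq_sqrt (by positivity), ← mul_add, ← hm, one_mul, div_mul_eq_mul_div,
      div_le_iff₀ (by positivity)]
    nlinarith
  obtain ⟨ρθ, hρθ, φω, hφω, hhjb, hfp, hT', h0⟩ :=
    hsol.exists_network_residuals_le hσ hσb hσc hT hΩ hU hΩU hH hη0
  have hEm : MeasurableSet (Icc 0 T ×ˢ Ω) := (isCompact_Icc.prod hΩ).measurableSet
  have hE : ∀ᵐ z ∂μ₁, z ∈ Icc 0 T ×ˢ Ω := hμ₁
  have hΩae : ∀ᵐ x ∂μ₂, x ∈ Ω := hμ₂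
  have hr1 : μ₁.restrict (Icc 0 T ×ˢ Ω) = μ₁ := Measure.restrict_eq_self_of_ae_mem hE
  have hr2 : μ₂.restrict Ω = μ₂ := Measure.restrict_eq_self_of_ae_mem hΩae
  have bhjb := hE.mono hhjb
  have bfp := hE.mono hfp
  have bT := hΩae.mono hT'
  have b0 := hΩae.mono h0
  have jρ := continuousOn_jet_network (Ω := Ω) hσ hT hρθ
  have jφ := continuousOn_jet_network (Ω := Ω) hσ hT hφω
  have hNet : ∀ N ∈ Networks d σ, ∀ z : ℝ × Space d, ContDiffAt ℝ 2 (N z.1) z.2 :=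
    fun N hN z => (contDiff_space (networks_contDiff hσ hN) z.1).contDiffAt
  refine ⟨ρθ, hρθ, φω, hφω, MemLp.of_bound ?_ η bhjb, MemLp.of_bound ?_ η bfp,
    MemLp.of_bound ?_ η bT, MemLp.of_bound ?_ η b0,
    (add_le_add (integral_sq_le_of_ae_abs_le bhjb) (integral_sq_le_of_ae_abs_le bT)).trans hηm,
    (add_le_add (integral_sq_le_of_ae_abs_le bfp) (integral_sq_le_of_ae_abs_le b0)).trans hηm⟩
  · rw [← hr1]
    have h1 := ((continuous_heatSymbol ν).comp_continuousOn jφ).aestronglyMeasurable (μ := μ₁) hEm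
    have h2 := aestronglyMeasurable_hamiltonian hΩ hH.measurable hH.lipschitz (μ := μ₁) jρ.fst
      jφ.snd.snd.fst
    exact (h1.sub h2).congr (Filter.Eventually.of_forall fun z =>
      (hjbResidual_eq (hNet φω hφω z)).symm)
  · rw [← hr1]
    refine ContinuousOn.aestronglyMeasurable ?_ hEm
    have h1 : ContinuousOn (fun z => fpSymbol ν H (z.2, jet T ρθ z, jet T φω z))
        (Icc 0 T ×ˢ Ω) :=
      (continuousOn_fpSymbol ν hU hH.contDiff_gradP).comp
        (continuous_snd.continuousOn.prodMk (jρ.prodMk jφ)) fun z hz => ⟨hΩU hz.2, mem_univ _⟩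
    exact h1.congr fun z hz => fpResidual_eq hU hH.contDiff_gradP (hΩU hz.2) (hNet ρθ hρθ z)
      (hNet φω hφω z)
  · rw [← hr2]
    refine ContinuousOn.aestronglyMeasurable ?_ hΩ.measurableSet
    exact (contDiff_space (networks_contDiff hσ hφω) T).continuous.continuousOn.sub
      ((hsol.regular_phi.contDiff_space T ⟨hT.le, le_rfl⟩).continuousOn.mono hΩU)
  · rw [← hr2]
    refine ContinuousOn.aestronglyMeasurable ?_ hΩ.measurableSet
    have h1 : ContinuousOn (fun x => ρθ 0 x - ρ 0 x) Ω :=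
      (contDiff_space (networks_contDiff hσ hρθ) 0).continuous.continuousOn.sub
        ((hsol.regular_rho.contDiff_space 0 ⟨le_rfl, hT.le⟩).continuousOn.mono hΩU)
    exact h1.congr fun x hx => by simp only [hsol.initial x hx]
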